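/- Let $g\ge 2$ be an integer and let $\mathbf p=(p_\alpha)_{\alpha\in\mathbb Z}$ be a finitely supported real sequence (the mask). The subdivision operator of arity $g$ is $(S_{\mathbf p}\mathbf c)_\alpha=\sum_{\beta\in\mathbb Z}p_{\alpha-g\beta}\,c_\beta$ for real sequences $\mathbf c$. A function $F$ is the limit function of the scheme for the initial data $\mathbf c$ if $F:\mathbb R\to\mathbb R$ is uniformly continuous and $\lim_{k\to\infty}\sup_{\alpha\in\mathbb Z}|F(\alpha/g^k)-(S_{\mathbf p}^k\mathbf c)_\alpha|=0$. The scheme is convergent if every $\mathbf c\in\ell^\infty(\mathbb Z)$ has a limit function; the limit function for $\boldsymbol\delta=(\delta_{\alpha,0})_{\alpha\in\mathbb Z}$ is the basic limit function $\phi$. A compactly supported $f\in L^\infty(\mathbb R)$ is $\ell^\infty$-stable if there are constants $0<A\le B<\infty$ with $$A\|\mathbf c\|_\infty\le\Big\|\sum_{\alpha\in\mathbb Z}c_\alpha f(\cdot-\alpha)\Big\|_{L^\infty(\mathbb R)}\le B\|\mathbf c\|_\infty\qquad\text{for all }\mathbf c\in\ell^\infty(\mathbb Z).$$ For integers $J\ge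 1$ and $0\le L\le J-1$, the binary ($g=2$) primal pseudo-spline scheme of order $(J,L)$ is the scheme whose mask $\mathbf p_{J,L}$ is the coefficient sequence of the Laurent polynomial $$p_{J,L}(z)=2\,\sigma(z)^J\sum_{k=0}^{L}\binom{J-1+k}{k}\,\delta(z)^k,\qquad \sigma(z)=\frac{(1+z)^2}{4z},\quad \delta(z)=-\frac{(1-z)^2}{4z}.$$ **Proposition.** For all integers $J\ge1$ and $0\le L\le J-1$, the binary primal pseudo-spline scheme $S_{\mathbf p_{J,L}}$ is convergent, and its basic limit function $\phi$ is bounded, compactly supported and $\ell^\infty$-stable. -/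

import Mathlib

open Filter Topology MeasureTheory
open scoped ENNReal LaurentPolynomial

namespace Subdivision

/-- The subdivision operator of arity `g` with mask `p`:
`(S_p c)_α = ∑_β p_{α - gβ} c_β` (a finite sum, since `p` is finitely supported and `g ≥ 2`). -/
noncomputable def subdivisionOp (g : ℕ) (p : ℤ →₀ ℝ) (c : ℤ → ℝ) : ℤ → ℝ :=
  fun α => ∑' β : ℤ, p (α - g * β) * c β

/-- `F` is the limit function of the subdivision scheme of arity `g` with mask `p` for the initial
data `c`: `F` is uniformly continuous and `sup_α |F (α / g^k) - (S_p^k c)_α| → 0` as `k → ∞`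
(the supremum is taken in `[0, ∞]`). -/
def IsLimitFunction (g : ℕ) (p : ℤ →₀ ℝ) (c : ℤ → ℝ) (F : ℝ → ℝ) : Prop :=
  UniformContinuous F ∧
    Tendsto (fun k : ℕ => ⨆ α : ℤ,
      ENNReal.ofReal |F ((α : ℝ) / (g : ℝ) ^ k) - ((subdivisionOp g p)^[k] c) α|)
      atTop (𝓝 0)

/-- The scheme converges: every bounded initial sequence has a limit function. -/
def IsConvergent (g : ℕ) (p : ℤ →₀ ℝ) : Prop :=
  ∀ c : lp (fun _ : ℤ => ℝ) ∞, ∃ F : ℝ → ℝ, IsLimitFunction g p c F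

/-- `φ` is the basic limit function, i.e. the limit function for the initial data
`δ = (…, 0, 0, 1, 0, 0, …)`. It is unique, being continuous and determined on the `g`-adic
rationals. -/
def IsBasicLimitFunction (g : ℕ) (p : ℤ →₀ ℝ) (φ : ℝ → ℝ) : Prop :=
  IsLimitFunction g p (Pi.single 0 1) φ

/-- `ℓ^∞`-stability (of the integer translates) of a compactly supported `f ∈ L^∞(ℝ)`:
`A ‖c‖_∞ ≤ ‖∑_α c_α f(· - α)‖_{L^∞(ℝ)} ≤ B ‖c‖_∞` for all bounded `c`, with `0 < A ≤ B < ∞`.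
Membership in `L^∞` and compactness of the support are part of the predicate. -/
def IsLInftyStable (f : ℝ → ℝ) : Prop :=
  MemLp f ∞ volume ∧ HasCompactSupport f ∧
    ∃ A B : ℝ, 0 < A ∧ A ≤ B ∧ ∀ c : lp (fun _ : ℤ => ℝ) ∞,
      ENNReal.ofReal (A * ‖c‖) ≤
          eLpNorm (fun t : ℝ => ∑' α : ℤ, c α * f (t - α)) ∞ volume ∧
        eLpNorm (fun t : ℝ => ∑' α : ℤ, c α * f (t - α)) ∞ volume ≤
          ENNReal.ofReal (B * ‖c‖)

/-- `σ(z) = (1 + z)² / (4 z)` as a Laurent polynomial. -/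
noncomputable def sigma : ℝ[T;T⁻¹] :=
  LaurentPolynomial.C (1 / 4) * (1 + LaurentPolynomial.T 1) ^ 2 * LaurentPolynomial.T (-1)

/-- `δ(z) = -(1 - z)² / (4 z)` as a Laurent polynomial. -/
noncomputable def delta : ℝ[T;T⁻¹] :=
  -(LaurentPolynomial.C (1 / 4) * (1 - LaurentPolynomial.T 1) ^ 2 * LaurentPolynomial.T (-1))

/-- `q_{J,L}(z) = ∑_{k=0}^{L} binom(J-1+k, k) δ(z)^k`, for `J ≥ 1`. -/
noncomputable def pseudoSplineQ (J L : ℕ) : ℝ[T;T⁻¹] :=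
  ∑ k ∈ Finset.range (L + 1), LaurentPolynomial.C ((J - 1 + k).choose k : ℝ) * delta ^ k

/-- The symbol `p_{J,L}(z) = 2 σ(z)^J q_{J,L}(z)` of the binary primal pseudo-spline scheme of
order `(J, L)`. -/
noncomputable def pseudoSplineSymbol (J L : ℕ) : ℝ[T;T⁻¹] :=
  2 * sigma ^ J * pseudoSplineQ J L

/-- The mask of the binary primal pseudo-spline scheme of order `(J, L)`: the coefficient sequence
`(p_α)` of its symbol `p_{J,L}(z) = ∑_α p_α z^α`. -/
noncomputable def pseudoSplineMask (J L : ℕ) : ℤ →₀ ℝ :=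
  (pseudoSplineSymbol J L).coeff

end Subdivision

/-! On the unit circle the symbol is `2 a(ω)`, where `a ≥ 0` is a polynomial in `y = sin² (ω / 2)`
and `cos (ω / 2) ^ (2 J) ≤ a ≤ b`, with `b` the case `L = J - 1`. That case is interpolatory: `b(ω)
+ b(ω + π) = 1`, so `b ≤ 1`.

Convergence: the candidate Fourier transform of `φ` is `∏_{j ≥ 1} a(ω / 2^j)`. The `k`-th iterate on
`δ` samples, at `α / 2^k`, the inverse transform of the first `k` factors cut off to `|ω| ≤ 2^k π`
(`subdivDelta_eq_cosTransform`). For `b` the cut-off products all have integral `2π`, so the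
infinite product of `b` is integrable; by Viète's formula a constant multiple of it dominates every
cut-off product of `a`. Dominated convergence gives `L¹` convergence
(`tendsto_integral_truncProd_sub`), hence uniform convergence of the iterates. General bounded data
follow by locally finite superposition.

Stability: a discrete Poisson summation and `a ≥ 0` give `∑ φ(m) cos (mω) ≥ (2/π)^(2J)` for `|ω| ≤
π` (`le_sum_basicLimitFunction_mul_cos`). The Laurent polynomial with coefficients `φ(m)` thus has
no zero on the circle, so convolution with it is bounded below on `ℓ^∞`
(`exists_norm_le_of_convolution_le`). That convolution gives the integer samples of `∑ c_α φ(· -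
α)`, whence the lower bound; the upper bound is local finiteness. -/

namespace Subdivision

/-! ### The half symbol: interpolatory identity and bounds -/

/-- The polynomial `(1 - y)^J ∑_{k ≤ L} binom(J-1+k, k) y^k`, which is half the pseudo-spline symbol
at `z = exp (iω)` in the variable `y = sin² (ω / 2)`. -/
noncomputable def halfSymbolPoly (J L : ℕ) (y : ℝ) : ℝ :=
  (1 - y) ^ J * ∑ k ∈ Finset.range (L + 1), ((J - 1 + k).choose k : ℝ) * y ^ k

/-- Pascal's rule: the factor `1 - y` lowers the upper index of the binomials by one and leaves a
single boundary term. -/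
lemma one_sub_mul_sum_choose (n : ℕ) (y : ℝ) :
    ∀ m : ℕ, (1 - y) * ∑ k ∈ Finset.range (m + 1), ((n + 1 + k).choose k : ℝ) * y ^ k =
      ∑ k ∈ Finset.range (m + 1), ((n + k).choose k : ℝ) * y ^ k -
        ((n + 1 + m).choose m : ℝ) * y ^ (m + 1)
  | 0 => by simp
  | m + 1 => by
    rw [Finset.sum_range_succ, mul_add, one_sub_mul_sum_choose n y m,
      Finset.sum_range_succ _ (m + 1)]
    have h : ((n + 1 + (m + 1)).choose (m + 1) : ℝ) =
        (n + 1 + m).choose m + (n + (m + 1)).choose (m + 1) := by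
      rw [← add_assoc (n + 1) m 1, Nat.choose_succ_succ]
      push_cast
      rw [show n + 1 + m = n + (m + 1) by ring]
    rw [h]
    ring

/-- The increment is odd under `y ↦ 1 - y`, so the symmetrised value is the same for every `n`. -/
lemma halfSymbolPoly_interp_succ (n : ℕ) (y : ℝ) :
    halfSymbolPoly (n + 2) (n + 1) y = halfSymbolPoly (n + 1) n y +
      ((2 * n + 1).choose (n + 1) : ℝ) * (y * (1 - y)) ^ (n + 1) * (1 - 2 * y) := by
  have h := one_sub_mul_sum_choose n y (n + 1)
  rw [Finset.sum_range_succ (fun k => ((n + k).choose k : ℝ) * y ^ k)] at h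
  have h2 : ((n + 1 + (n + 1)).choose (n + 1) : ℝ) = 2 * (2 * n + 1).choose (n + 1) := by
    rw [← add_assoc (n + 1) n 1, Nat.choose_succ_succ]
    have : (n + 1 + n).choose n = (n + 1 + n).choose (n + 1) :=
      Nat.choose_symm_of_eq_add (by ring)
    rw [this, show n + 1 + n = 2 * n + 1 by ring]
    push_cast
    ring
  have h3 : n + (n + 1) = 2 * n + 1 := by ring
  rw [h2, h3] at h
  unfold halfSymbolPoly
  simp only [Nat.add_sub_cancel, show n + 2 - 1 = n + 1 by omega]
  rw [pow_succ, mul_assoc, h, mul_pow]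
  ring

lemma halfSymbolPoly_interp_add (n : ℕ) (y : ℝ) :
    halfSymbolPoly (n + 1) n y + halfSymbolPoly (n + 1) n (1 - y) = 1 := by
  induction n with
  | zero => simp [halfSymbolPoly]
  | succ n ih =>
    rw [halfSymbolPoly_interp_succ, halfSymbolPoly_interp_succ]
    linear_combination ih

lemma halfSymbolPoly_nonneg (J L : ℕ) {y : ℝ} (h0 : 0 ≤ y) (h1 : y ≤ 1) :
    0 ≤ halfSymbolPoly J L y := by
  have : 0 ≤ 1 - y := by linarith
  unfold halfSymbolPoly
  positivity

/-- The term `k = 0` of the sum is already `1`. -/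
lemma pow_le_halfSymbolPoly (J L : ℕ) {y : ℝ} (h0 : 0 ≤ y) (h1 : y ≤ 1) :
    (1 - y) ^ J ≤ halfSymbolPoly J L y := by
  have : 0 ≤ 1 - y := by linarith
  unfold halfSymbolPoly
  refine le_mul_of_one_le_right (by positivity) ?_
  rw [Finset.sum_range_succ']
  have : 0 ≤ ∑ k ∈ Finset.range L, ((J - 1 + (k + 1)).choose (k + 1) : ℝ) * y ^ (k + 1) := by
    positivity
  simpa using this

lemma halfSymbolPoly_mono (J : ℕ) {L M : ℕ} (h : L ≤ M) {y : ℝ} (h0 : 0 ≤ y) (h1 : y ≤ 1) :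
    halfSymbolPoly J L y ≤ halfSymbolPoly J M y := by
  have : 0 ≤ 1 - y := by linarith
  unfold halfSymbolPoly
  refine mul_le_mul_of_nonneg_left ?_ (by positivity)
  exact Finset.sum_le_sum_of_subset_of_nonneg (Finset.range_mono (by omega))
    fun k _ _ => by positivity

/-- Half of the pseudo-spline symbol at `exp (iω)`. -/
noncomputable def halfSymbol (J L : ℕ) (ω : ℝ) : ℝ :=
  halfSymbolPoly J L (Real.sin (ω / 2) ^ 2)

lemma continuous_halfSymbol (J L : ℕ) : Continuous (halfSymbol J L) := by
  unfold halfSymbol halfSymbolPoly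
  fun_prop

lemma halfSymbol_nonneg (J L : ℕ) (ω : ℝ) : 0 ≤ halfSymbol J L ω :=
  halfSymbolPoly_nonneg J L (sq_nonneg _) (Real.sin_sq_le_one _)

lemma halfSymbol_mono (J : ℕ) {L M : ℕ} (h : L ≤ M) (ω : ℝ) :
    halfSymbol J L ω ≤ halfSymbol J M ω :=
  halfSymbolPoly_mono J h (sq_nonneg _) (Real.sin_sq_le_one _)

lemma cos_pow_le_halfSymbol (J L : ℕ) (ω : ℝ) :
    Real.cos (ω / 2) ^ (2 * J) ≤ halfSymbol J L ω := by
  rw [pow_mul, Real.cos_sq']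
  exact pow_le_halfSymbolPoly J L (sq_nonneg _) (Real.sin_sq_le_one _)

lemma halfSymbol_add_two_pi (J L : ℕ) (ω : ℝ) :
    halfSymbol J L (ω + 2 * Real.pi) = halfSymbol J L ω := by
  unfold halfSymbol
  rw [show (ω + 2 * Real.pi) / 2 = ω / 2 + Real.pi by ring, Real.sin_add_pi, neg_sq]

lemma halfSymbol_interp_add_pi (n : ℕ) (ω : ℝ) :
    halfSymbol (n + 1) n ω + halfSymbol (n + 1) n (ω + Real.pi) = 1 := by
  unfold halfSymbol
  rw [show (ω + Real.pi) / 2 = ω / 2 + Real.pi / 2 by ring, Real.sin_add_pi_div_two,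
    Real.cos_sq']
  exact halfSymbolPoly_interp_add n _

lemma halfSymbol_le_one {J L : ℕ} (hJ : 1 ≤ J) (hL : L ≤ J - 1) (ω : ℝ) :
    halfSymbol J L ω ≤ 1 := by
  obtain ⟨n, rfl⟩ : ∃ n, J = n + 1 := ⟨J - 1, by omega⟩
  have h := halfSymbol_interp_add_pi n ω
  have h1 := halfSymbol_nonneg (n + 1) n (ω + Real.pi)
  have h2 := halfSymbol_mono (n + 1) (L := L) (M := n) (by omega) ω
  linarith

/-! ### The symbol on the unit circle -/

/-- Evaluation of real Laurent polynomials at `exp (iω)`. -/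
noncomputable def evalCircle (ω : ℝ) : ℝ[T;T⁻¹] →ₐ[ℝ] ℂ :=
  AddMonoidAlgebra.lift ℝ ℂ ℤ
    { toFun := fun n => Complex.exp ((n.toAdd : ℝ) * ω * Complex.I)
      map_one' := by simp
      map_mul' := fun m n => by
        rw [← Complex.exp_add]
        congr 1
        push_cast [toAdd_mul]
        ring }

lemma evalCircle_apply (ω : ℝ) (f : ℝ[T;T⁻¹]) :
    evalCircle ω f =
      ∑ n ∈ f.coeff.support, (f.coeff n : ℂ) * Complex.exp ((n : ℝ) * ω * Complex.I) := by
  simp [evalCircle, AddMonoidAlgebra.lift_apply, Finsupp.sum]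

lemma evalCircle_T (ω : ℝ) (n : ℤ) :
    evalCircle ω (LaurentPolynomial.T n) = Complex.exp ((n : ℝ) * ω * Complex.I) := by
  exact (AddMonoidAlgebra.lift_single _ _ _).trans (by simp)

lemma evalCircle_C (ω : ℝ) (r : ℝ) : evalCircle ω (LaurentPolynomial.C r) = (r : ℂ) := by
  exact (evalCircle ω).commutes r

lemma evalCircle_delta (ω : ℝ) : evalCircle ω delta = ((Real.sin (ω / 2) ^ 2 : ℝ) : ℂ) := by
  simp only [delta, map_neg, map_mul, map_pow, map_sub, map_one, evalCircle_C, evalCircle_T]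
  push_cast
  rw [Complex.sin]
  set e := Complex.exp (ω / 2 * Complex.I) with he
  have h1 : Complex.exp (-(ω / 2) * Complex.I) = e⁻¹ := by
    rw [he, ← Complex.exp_neg]; congr 1; ring
  have h2 : Complex.exp (1 * ω * Complex.I) = e ^ 2 := by
    rw [he, ← Complex.exp_nat_mul]; congr 1; push_cast; ring
  have h3 : Complex.exp (-1 * ω * Complex.I) = (e ^ 2)⁻¹ := by
    rw [← h2, ← Complex.exp_neg]; congr 1; ring
  have h0 : e ≠ 0 := Complex.exp_ne_zero _
  rw [h1, h2, h3]
  field_simp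
  linear_combination (-4 * (1 - e ^ 2) ^ 2) * Complex.I_sq

lemma sigma_add_delta : sigma + delta = 1 := by
  have h : (LaurentPolynomial.C (1 / 4 : ℝ) * 4 : ℝ[T;T⁻¹]) = 1 := by
    rw [show (4 : ℝ[T;T⁻¹]) = LaurentPolynomial.C 4 from (map_ofNat LaurentPolynomial.C 4).symm,
      ← map_mul]
    norm_num
  have h2 : (LaurentPolynomial.T 1 * LaurentPolynomial.T (-1) : ℝ[T;T⁻¹]) = 1 := by
    rw [← LaurentPolynomial.T_add]; simp
  unfold sigma delta
  linear_combination h + LaurentPolynomial.C (1 / 4 : ℝ) * 4 * h2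

lemma evalCircle_symbol (J L : ℕ) (ω : ℝ) :
    evalCircle ω (pseudoSplineSymbol J L) = ((2 * halfSymbol J L ω : ℝ) : ℂ) := by
  have h : sigma = 1 - delta := eq_sub_of_add_eq sigma_add_delta
  simp only [pseudoSplineSymbol, pseudoSplineQ, h, map_mul, map_pow, map_sub, map_one, map_sum,
    evalCircle_delta, evalCircle_C, halfSymbol, halfSymbolPoly, map_ofNat]
  push_cast
  ring

lemma sum_pseudoSplineMask_exp (J L : ℕ) (ω : ℝ) :
    ∑ n ∈ (pseudoSplineMask J L).support,
      (pseudoSplineMask J L n : ℂ) * Complex.exp ((n : ℝ) * ω * Complex.I) =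
        ((2 * halfSymbol J L ω : ℝ) : ℂ) := by
  rw [← evalCircle_symbol, evalCircle_apply]
  rfl

/-! ### Dyadic products and their integrals -/

/-- The partial product `∏_{j=1}^k a (ω / 2^j)`. -/
noncomputable def dyadicProd (a : ℝ → ℝ) (k : ℕ) (ω : ℝ) : ℝ :=
  ∏ j ∈ Finset.range k, a (ω / 2 ^ (j + 1))

/-- The infinite product `∏_{j≥1} a (ω / 2^j)` for `0 ≤ a ≤ 1`. -/
noncomputable def dyadicInfProd (a : ℝ → ℝ) (ω : ℝ) : ℝ := ⨅ k, dyadicProd a k ω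

lemma dyadicProd_add (a : ℝ → ℝ) (k m : ℕ) (ω : ℝ) :
    dyadicProd a (k + m) ω = dyadicProd a k ω * dyadicProd a m (ω / 2 ^ k) := by
  simp only [dyadicProd, Finset.prod_range_add]
  congr 1
  refine Finset.prod_congr rfl fun j _ => ?_
  rw [div_div, ← pow_add, add_assoc]

/-- Rescaling reverses the factors, linking the product on the Fourier side to the symbol of the
`k`-th iterate. -/
lemma dyadicProd_eq_prod_mul (a : ℝ → ℝ) (k : ℕ) (ω : ℝ) :
    dyadicProd a k (2 ^ k * ω) = ∏ j ∈ Finset.range k, a (2 ^ j * ω) := by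
  unfold dyadicProd
  rw [← Finset.prod_range_reflect]
  refine Finset.prod_congr rfl fun j hj => ?_
  have hj' := Finset.mem_range.1 hj
  congr 1
  have : (2 : ℝ) ^ k = 2 ^ j * 2 ^ (k - 1 - j + 1) := by
    rw [← pow_add]; congr 1; omega
  rw [this]
  field_simp

lemma continuous_dyadicProd {a : ℝ → ℝ} (ha : Continuous a) (k : ℕ) :
    Continuous (dyadicProd a k) := by
  unfold dyadicProd
  fun_prop

section
variable {a : ℝ → ℝ}

lemma dyadicProd_nonneg (h0 : ∀ ω, 0 ≤ a ω) (k : ℕ) (ω : ℝ) : 0 ≤ dyadicProd a k ω :=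
  Finset.prod_nonneg fun _ _ => h0 _

lemma dyadicProd_le_one (h0 : ∀ ω, 0 ≤ a ω) (h1 : ∀ ω, a ω ≤ 1) (k : ℕ) (ω : ℝ) :
    dyadicProd a k ω ≤ 1 :=
  Finset.prod_le_one (fun _ _ => h0 _) fun _ _ => h1 _

lemma dyadicProd_antitone (h0 : ∀ ω, 0 ≤ a ω) (h1 : ∀ ω, a ω ≤ 1) (ω : ℝ) :
    Antitone fun k => dyadicProd a k ω :=
  antitone_nat_of_succ_le fun k => by
    rw [dyadicProd_add]
    exact mul_le_of_le_one_right (dyadicProd_nonneg h0 k ω) (dyadicProd_le_one h0 h1 1 _)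

lemma bddBelow_dyadicProd (h0 : ∀ ω, 0 ≤ a ω) (ω : ℝ) :
    BddBelow (Set.range fun k => dyadicProd a k ω) :=
  ⟨0, by rintro _ ⟨k, rfl⟩; exact dyadicProd_nonneg h0 k ω⟩

lemma tendsto_dyadicProd (h0 : ∀ ω, 0 ≤ a ω) (h1 : ∀ ω, a ω ≤ 1) (ω : ℝ) :
    Tendsto (fun k => dyadicProd a k ω) atTop (𝓝 (dyadicInfProd a ω)) :=
  tendsto_atTop_ciInf (dyadicProd_antitone h0 h1 ω) (bddBelow_dyadicProd h0 ω)

lemma dyadicInfProd_le (h0 : ∀ ω, 0 ≤ a ω) (k : ℕ) (ω : ℝ) :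
    dyadicInfProd a ω ≤ dyadicProd a k ω :=
  ciInf_le (bddBelow_dyadicProd h0 ω) k

lemma dyadicInfProd_nonneg (h0 : ∀ ω, 0 ≤ a ω) (ω : ℝ) : 0 ≤ dyadicInfProd a ω :=
  le_ciInf fun k => dyadicProd_nonneg h0 k ω

lemma measurable_dyadicInfProd (ha : Continuous a) : Measurable (dyadicInfProd a) :=
  Measurable.iInf fun k => (continuous_dyadicProd ha k).measurable

/-- Viète's product. -/
lemma prod_cos_mul_sin (θ : ℝ) (k : ℕ) :
    (∏ j ∈ Finset.range k, Real.cos (θ / 2 ^ (j + 1))) * (2 ^ k * Real.sin (θ / 2 ^ k)) =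
      Real.sin θ := by
  induction k with
  | zero => simp
  | succ k ih =>
    rw [← ih, Finset.prod_range_succ]
    have : θ / 2 ^ k = 2 * (θ / 2 ^ (k + 1)) := by rw [pow_succ]; field_simp
    rw [this, Real.sin_two_mul]
    ring

/-- By Viète the product is `sin θ / (2^k sin (θ / 2^k)) ≥ sin θ / θ`, and Jordan's inequality
bounds this below by `2 / π`. -/
lemma two_div_pi_le_prod_cos {θ : ℝ} (h : |θ| ≤ Real.pi / 2) (k : ℕ) :
    2 / Real.pi ≤ ∏ j ∈ Finset.range k, Real.cos (θ / 2 ^ (j + 1)) := by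
  have hcos : ∀ j : ℕ, Real.cos (θ / 2 ^ (j + 1)) = Real.cos (|θ| / 2 ^ (j + 1)) := fun j => by
    rw [← Real.cos_abs, abs_div, abs_of_pos (by positivity : (0 : ℝ) < 2 ^ (j + 1))]
  simp only [hcos]
  rcases (abs_nonneg θ).eq_or_lt with h0 | h0
  · rw [← h0]
    simpa using (div_le_one Real.pi_pos).2 Real.two_le_pi
  set t := |θ|
  have hP : 0 ≤ ∏ j ∈ Finset.range k, Real.cos (t / 2 ^ (j + 1)) := by
    refine Finset.prod_nonneg fun j _ => Real.cos_nonneg_of_mem_Icc ⟨?_, ?_⟩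
    · have : 0 ≤ t / 2 ^ (j + 1) := by positivity
      linarith [Real.pi_pos]
    · exact (div_le_self h0.le (one_le_pow₀ one_le_two)).trans h
  have h1 : 2 ^ k * Real.sin (t / 2 ^ k) ≤ t := by
    have := Real.sin_le (by positivity : 0 ≤ t / 2 ^ k)
    calc 2 ^ k * Real.sin (t / 2 ^ k) ≤ 2 ^ k * (t / 2 ^ k) := by gcongr
      _ = t := by field_simp
  have h2 := Real.mul_le_sin h0.le h
  rw [← prod_cos_mul_sin t k] at h2
  exact le_of_mul_le_mul_right (h2.trans (mul_le_mul_of_nonneg_left h1 hP)) h0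

lemma le_dyadicProd {J : ℕ} (hc : ∀ ω, Real.cos (ω / 2) ^ (2 * J) ≤ a ω) {ω : ℝ}
    (hω : |ω| ≤ Real.pi) (k : ℕ) : (2 / Real.pi) ^ (2 * J) ≤ dyadicProd a k ω := by
  have h : |ω / 2| ≤ Real.pi / 2 := by
    rw [abs_div, abs_two]; linarith
  calc (2 / Real.pi) ^ (2 * J)
      ≤ (∏ j ∈ Finset.range k, Real.cos (ω / 2 / 2 ^ (j + 1))) ^ (2 * J) :=
        pow_le_pow_left₀ (by positivity) (two_div_pi_le_prod_cos h k) _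
    _ = ∏ j ∈ Finset.range k, Real.cos (ω / 2 ^ (j + 1) / 2) ^ (2 * J) := by
        rw [← Finset.prod_pow]
        refine Finset.prod_congr rfl fun j _ => ?_
        rw [div_right_comm]
    _ ≤ _ := Finset.prod_le_prod (fun j _ => (even_two_mul J).pow_nonneg _) fun j _ => hc _

/-- The factors after the `k`-th form a product at `ω / 2^k ∈ [-π, π]`, where the Viète bound is
uniform. This reverse estimate supplies the integrable majorant. -/
lemma mul_dyadicProd_le_dyadicInfProd (h0 : ∀ ω, 0 ≤ a ω) (h1 : ∀ ω, a ω ≤ 1) {J : ℕ}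
    (hc : ∀ ω, Real.cos (ω / 2) ^ (2 * J) ≤ a ω) {k : ℕ} {ω : ℝ}
    (hω : |ω| ≤ 2 ^ k * Real.pi) :
    (2 / Real.pi) ^ (2 * J) * dyadicProd a k ω ≤ dyadicInfProd a ω := by
  have hω' : |ω / 2 ^ k| ≤ Real.pi := by
    rw [abs_div, abs_of_pos (by positivity : (0 : ℝ) < 2 ^ k), div_le_iff₀ (by positivity)]
    linarith
  refine le_ciInf fun m => ?_
  refine le_trans ?_ (dyadicProd_antitone h0 h1 ω (Nat.le_add_left m k))
  simp only [dyadicProd_add]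
  rw [mul_comm]
  exact mul_le_mul_of_nonneg_left (le_dyadicProd hc hω' m) (dyadicProd_nonneg h0 k ω)

/-- Folding: `ω` and `ω + π` give the same value `G (2ω)`, and their weights add up to `1`. -/
lemma integral_mul_comp_two_mul (ha : Continuous a)
    (hadd : ∀ ω, a ω + a (ω + Real.pi) = 1) {G : ℝ → ℝ} (hG : Continuous G)
    (hGp : Function.Periodic G (2 * Real.pi)) :
    2 * ∫ ω in (-Real.pi)..Real.pi, a ω * G (2 * ω) = ∫ ω in (-Real.pi)..Real.pi, G ω := by
  have hi : ∀ x y, IntervalIntegrable (fun ω => a ω * G (2 * ω)) volume x y := fun x y =>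
    (by fun_prop : Continuous fun ω => a ω * G (2 * ω)).intervalIntegrable x y
  have hi' : IntervalIntegrable (fun ω => a (ω + Real.pi) * G (2 * ω)) volume (-Real.pi) 0 :=
    (by fun_prop : Continuous fun ω => a (ω + Real.pi) * G (2 * ω)).intervalIntegrable _ _
  have h1 : ∫ ω in (0)..Real.pi, a ω * G (2 * ω) =
      ∫ ω in (-Real.pi)..0, a (ω + Real.pi) * G (2 * ω) := by
    have := intervalIntegral.integral_comp_add_right (a := -Real.pi) (b := 0)
      (fun ω => a ω * G (2 * ω)) Real.pi
    simp only [neg_add_cancel, zero_add] at this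
    rw [← this]
    refine intervalIntegral.integral_congr fun ω _ => ?_
    simp only [mul_add, hGp (2 * ω)]
  rw [← intervalIntegral.integral_add_adjacent_intervals (hi _ 0) (hi 0 _), h1,
    ← intervalIntegral.integral_add (hi _ _) hi']
  have h2 : ∀ ω, a ω * G (2 * ω) + a (ω + Real.pi) * G (2 * ω) = G (2 * ω) := fun ω => by
    rw [← add_mul, hadd, one_mul]
  simp only [h2]
  rw [intervalIntegral.integral_comp_mul_left _ two_ne_zero, smul_eq_mul, mul_zero,
    mul_inv_cancel_left₀ two_ne_zero]
  have h3 := hGp.intervalIntegral_add_eq (2 * -Real.pi) (-Real.pi)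
  rw [show 2 * -Real.pi + 2 * Real.pi = 0 by ring,
    show -Real.pi + 2 * Real.pi = Real.pi by ring] at h3
  exact h3

lemma integral_dyadicProd (k : ℕ) (f : ℝ → ℝ) :
    ∫ ω in (-(2 ^ k * Real.pi))..(2 ^ k * Real.pi), dyadicProd a k ω * f ω =
      2 ^ k * ∫ ω in (-Real.pi)..Real.pi,
        (∏ j ∈ Finset.range k, a (2 ^ j * ω)) * f (2 ^ k * ω) := by
  simp only [← dyadicProd_eq_prod_mul]
  rw [intervalIntegral.integral_comp_mul_left (fun ω => dyadicProd a k ω * f ω)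
    (by positivity : (2 : ℝ) ^ k ≠ 0), smul_eq_mul, mul_inv_cancel_left₀ (by positivity), mul_neg]

lemma integral_dyadicProd_eq_two_pi (ha : Continuous a)
    (hp : ∀ ω, a (ω + 2 * Real.pi) = a ω) (hadd : ∀ ω, a ω + a (ω + Real.pi) = 1) (k : ℕ) :
    ∫ ω in (-(2 ^ k * Real.pi))..(2 ^ k * Real.pi), dyadicProd a k ω = 2 * Real.pi := by
  have h := integral_dyadicProd (a := a) k fun _ => 1
  simp only [mul_one] at h
  rw [h]
  clear h
  induction k with
  | zero => simp; ring
  | succ k ih =>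
    rw [← ih, ← integral_mul_comp_two_mul (a := a) ha hadd
      (G := fun ω => ∏ j ∈ Finset.range k, a (2 ^ j * ω)) (by fun_prop), ← mul_assoc, ← pow_succ]
    · congr 1
      refine intervalIntegral.integral_congr fun ω _ => ?_
      simp only [Finset.prod_range_succ', pow_zero, one_mul, pow_succ, mul_assoc]
      rw [mul_comm]
    · intro ω
      refine Finset.prod_congr rfl fun j _ => ?_
      have hper : Function.Periodic a (2 * Real.pi) := hp
      have := hper.nat_mul (2 ^ j) (2 ^ j * ω)
      rw [← this]
      congr 1
      push_cast
      ring

/-- The infinite product lies below each partial product, whose integral over `(-2^k π, 2^k π)` is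
`2π`; these intervals exhaust the line. -/
lemma integrable_dyadicInfProd (ha : Continuous a) (h0 : ∀ ω, 0 ≤ a ω) (h1 : ∀ ω, a ω ≤ 1)
    (hp : ∀ ω, a (ω + 2 * Real.pi) = a ω) (hadd : ∀ ω, a ω + a (ω + Real.pi) = 1) :
    Integrable (dyadicInfProd a) := by
  have hT : Tendsto (fun k : ℕ => (2 : ℝ) ^ k * Real.pi) atTop atTop :=
    (tendsto_pow_atTop_atTop_of_one_lt one_lt_two).atTop_mul_const Real.pi_pos
  have hloc : ∀ x y : ℝ, IntegrableOn (dyadicInfProd a) (Set.Ioc x y) := fun x y => by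
    refine Integrable.mono' (g := fun _ => (1 : ℝ)) ?_
      (measurable_dyadicInfProd ha).aestronglyMeasurable ?_
    · exact integrable_const _
    · refine Eventually.of_forall fun ω => ?_
      rw [Real.norm_of_nonneg (dyadicInfProd_nonneg h0 ω)]
      exact (dyadicInfProd_le h0 0 ω).trans (dyadicProd_le_one h0 h1 0 ω)
  refine integrable_of_intervalIntegral_norm_bounded (l := atTop) (2 * Real.pi)
    (a := fun k : ℕ => -((2 : ℝ) ^ k * Real.pi)) (b := fun k : ℕ => (2 : ℝ) ^ k * Real.pi)
    (fun k => hloc _ _) (tendsto_neg_atTop_atBot.comp hT) hT (Eventually.of_forall fun k => ?_)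
  have hle : -((2 : ℝ) ^ k * Real.pi) ≤ 2 ^ k * Real.pi := by
    have : 0 ≤ (2 : ℝ) ^ k * Real.pi := by positivity
    linarith
  rw [← integral_dyadicProd_eq_two_pi ha hp hadd k]
  refine intervalIntegral.integral_mono_on hle ?_
    ((continuous_dyadicProd ha k).intervalIntegrable _ _) fun ω _ => ?_
  · rw [intervalIntegrable_iff_integrableOn_Ioc_of_le hle]
    exact (hloc _ _).norm
  · rw [Real.norm_of_nonneg (dyadicInfProd_nonneg h0 ω)]
    exact dyadicInfProd_le h0 k ω

end

/-! ### `L¹` convergence of the truncated products -/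

/-- The partial product cut off to `(-2^k π, 2^k π]`. -/
noncomputable def truncProd (a : ℝ → ℝ) (k : ℕ) : ℝ → ℝ :=
  (Set.Ioc (-(2 ^ k * Real.pi)) (2 ^ k * Real.pi)).indicator (dyadicProd a k)

/-- Partial products dominated by those of a nonnegative interpolatory symbol converge in `L¹`. -/
lemma tendsto_integral_truncProd_sub {a b : ℝ → ℝ} (ha : Continuous a) (h0 : ∀ ω, 0 ≤ a ω)
    (hab : ∀ ω, a ω ≤ b ω) (hb : Continuous b) (hb1 : ∀ ω, b ω ≤ 1)
    (hp : ∀ ω, b (ω + 2 * Real.pi) = b ω) (hadd : ∀ ω, b ω + b (ω + Real.pi) = 1)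
    {J : ℕ} (hc : ∀ ω, Real.cos (ω / 2) ^ (2 * J) ≤ b ω) :
    (∀ k, Integrable (truncProd a k)) ∧ Integrable (dyadicInfProd a) ∧
      Tendsto (fun k => ∫ ω, |truncProd a k ω - dyadicInfProd a ω|) atTop (𝓝 0) := by
  have hb0 : ∀ ω, 0 ≤ b ω := fun ω => (h0 ω).trans (hab ω)
  have h1 : ∀ ω, a ω ≤ 1 := fun ω => (hab ω).trans (hb1 ω)
  have hB := integrable_dyadicInfProd hb hb0 hb1 hp hadd
  have hprod : ∀ k ω, dyadicProd a k ω ≤ dyadicProd b k ω := fun k ω =>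
    Finset.prod_le_prod (fun _ _ => h0 _) fun _ _ => hab _
  have hinf : ∀ ω, dyadicInfProd a ω ≤ dyadicInfProd b ω := fun ω =>
    le_ciInf fun k => (dyadicInfProd_le h0 k ω).trans (hprod k ω)
  have hA : Integrable (dyadicInfProd a) := by
    refine hB.mono' (measurable_dyadicInfProd ha).aestronglyMeasurable
      (Eventually.of_forall fun ω => ?_)
    rw [Real.norm_of_nonneg (dyadicInfProd_nonneg h0 ω)]
    exact hinf ω
  set c : ℝ := (2 / Real.pi) ^ (2 * J) with hcdef
  have hcpos : 0 < c := by have := Real.pi_pos; positivity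
  have hmeas : ∀ k, Measurable (truncProd a k) := fun k =>
    (continuous_dyadicProd ha k).measurable.indicator measurableSet_Ioc
  have htr0 : ∀ k ω, 0 ≤ truncProd a k ω := fun k ω =>
    Set.indicator_nonneg (fun x _ => dyadicProd_nonneg h0 k x) ω
  have hdom : ∀ k ω, truncProd a k ω ≤ c⁻¹ * dyadicInfProd b ω := fun k ω => by
    refine Set.indicator_apply_le' (fun hω => ?_)
      fun _ => mul_nonneg (by positivity) (dyadicInfProd_nonneg hb0 ω)
    rw [le_inv_mul_iff₀ hcpos]
    refine (mul_le_mul_of_nonneg_left (hprod k ω) hcpos.le).trans ?_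
    exact mul_dyadicProd_le_dyadicInfProd hb0 hb1 hc (abs_le.2 ⟨hω.1.le, hω.2⟩)
  have htrint : ∀ k, Integrable (truncProd a k) := fun k => by
    refine (hB.const_mul c⁻¹).mono' (hmeas k).aestronglyMeasurable (Eventually.of_forall fun ω => ?_)
    rw [Real.norm_of_nonneg (htr0 k ω)]
    exact hdom k ω
  refine ⟨htrint, hA, ?_⟩
  have hT : Tendsto (fun k : ℕ => (2 : ℝ) ^ k * Real.pi) atTop atTop :=
    (tendsto_pow_atTop_atTop_of_one_lt one_lt_two).atTop_mul_const Real.pi_pos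
  have := tendsto_integral_of_dominated_convergence (μ := volume)
    (F := fun k ω => |truncProd a k ω - dyadicInfProd a ω|) (f := fun _ => (0 : ℝ))
    (fun ω => c⁻¹ * dyadicInfProd b ω + dyadicInfProd b ω)
    (fun k => ((htrint k).sub hA).abs.aestronglyMeasurable) ((hB.const_mul c⁻¹).add hB)
    (fun k => Eventually.of_forall fun ω => by
      rw [Real.norm_eq_abs, abs_abs]
      refine (abs_sub _ _).trans ?_
      rw [abs_of_nonneg (htr0 k ω), abs_of_nonneg (dyadicInfProd_nonneg h0 ω)]
      exact add_le_add (hdom k ω) (hinf ω))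
    (Eventually.of_forall fun ω => by
      -- For fixed `ω` the cut-off is eventually inactive.
      have h2 : Tendsto (fun k => truncProd a k ω) atTop (𝓝 (dyadicInfProd a ω)) := by
        refine (tendsto_dyadicProd h0 h1 ω).congr' ?_
        filter_upwards [hT.eventually_gt_atTop |ω|] with k hk
        have := abs_lt.1 hk
        rw [truncProd, Set.indicator_of_mem (Set.mem_Ioc.2 ⟨this.1, this.2.le⟩)]
      have h3 := (h2.sub_const (dyadicInfProd a ω)).abs
      simpa using h3)
  simpa using this

/-! ### Iterates on `δ` and their Fourier representation -/

/-- The `k`-th iterate of the binary subdivision operator applied to `δ`. -/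
noncomputable def subdivDelta (p : ℤ →₀ ℝ) (k : ℕ) : ℤ → ℝ :=
  (subdivisionOp 2 p)^[k] (Pi.single 0 1)

section
variable {p : ℤ →₀ ℝ}

lemma injective_sub_two_mul (α : ℤ) : Function.Injective fun β : ℤ => α - (2 : ℕ) * β :=
  fun β γ h => by
    simp only [Nat.cast_ofNat] at h
    omega

lemma subdivisionOp_eq_sum (c : ℤ → ℝ) (α : ℤ) :
    subdivisionOp 2 p c α =
      ∑ β ∈ p.support.preimage _ (injective_sub_two_mul α).injOn,
        p (α - (2 : ℕ) * β) * c β :=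
  tsum_eq_sum fun β hβ => by
    rw [Finset.mem_preimage, Finsupp.notMem_support_iff] at hβ
    rw [hβ, zero_mul]

lemma subdivDelta_succ (k : ℕ) (α : ℤ) :
    subdivDelta p (k + 1) α = ∑' β : ℤ, p (α - (2 : ℕ) * β) * subdivDelta p k β := by
  unfold subdivDelta
  rw [Function.iterate_succ_apply']
  rfl

lemma subdivDelta_one : subdivDelta p 1 = p := by
  ext α
  rw [subdivDelta_succ, tsum_eq_single 0]
  · simp [subdivDelta]
  · intro β hβ
    simp [subdivDelta, hβ]

lemma exists_support_bound (p : ℤ →₀ ℝ) : ∃ N : ℕ, 1 ≤ N ∧ ∀ α, p α ≠ 0 → |α| ≤ N := by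
  -- The `+ 1` secures `1 ≤ N`.
  refine ⟨p.support.sup Int.natAbs + 1, by omega, fun α hα => ?_⟩
  rw [Int.abs_eq_natAbs]
  exact_mod_cast (Finset.le_sup (f := Int.natAbs) (Finsupp.mem_support_iff.2 hα)).trans
    (Nat.le_succ _)

/-- The bound is `|α| ≤ N (2^k - 1)`, written without subtraction; for `N ≥ 1` it is strictly
stronger than `|α| < N 2^k + 1`. -/
lemma abs_le_of_subdivDelta_ne_zero {N : ℕ} (hN : ∀ α, p α ≠ 0 → |α| ≤ N) (k : ℕ) :
    ∀ α, subdivDelta p k α ≠ 0 → |α| + N ≤ N * 2 ^ k := by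
  induction k with
  | zero =>
    intro α hα
    have : α = 0 := by
      by_contra h
      simp [subdivDelta, h] at hα
    simp [this]
  | succ k ih =>
    intro α hα
    rw [subdivDelta_succ] at hα
    obtain ⟨β, hβ⟩ : ∃ β : ℤ, p (α - (2 : ℕ) * β) * subdivDelta p k β ≠ 0 := by
      by_contra! h
      exact hα (by simp only [h, tsum_zero])
    have h1 := hN _ (left_ne_zero_of_mul hβ)
    have h2 := ih _ (right_ne_zero_of_mul hβ)
    push_cast at h1
    have h3 : |α| ≤ |α - 2 * β| + 2 * |β| := by
      calc |α| = |(α - 2 * β) + 2 * β| := by ring_nf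
        _ ≤ |α - 2 * β| + |2 * β| := abs_add_le _ _
        _ = _ := by rw [abs_mul, abs_two]
    rw [pow_succ]
    linarith

lemma finite_support_subdivDelta (p : ℤ →₀ ℝ) (k : ℕ) :
    (Function.support (subdivDelta p k)).Finite := by
  obtain ⟨N, -, hN⟩ := exists_support_bound p
  refine (Set.finite_Icc (-(N * 2 ^ k : ℤ)) (N * 2 ^ k)).subset fun α hα => ?_
  have := abs_le_of_subdivDelta_ne_zero hN k α hα
  exact abs_le.1 (by linarith [Int.natCast_nonneg N])

lemma injective_sub_two_pow_mul (k : ℕ) (α : ℤ) :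
    Function.Injective fun β : ℤ => α - 2 ^ k * β := fun β γ h => by
  have h' : (2 : ℤ) ^ k * β = 2 ^ k * γ := by
    simpa using h
  exact mul_left_cancel₀ (by positivity) h'

lemma summable_mul_subdivDelta (c : ℤ → ℝ) (k : ℕ) (α : ℤ) :
    Summable fun β : ℤ => c β * subdivDelta p k (α - 2 ^ k * β) := by
  refine summable_of_hasFiniteSupport ?_
  refine ((finite_support_subdivDelta p k).preimage
    (injective_sub_two_pow_mul k α).injOn).subset fun β hβ => ?_
  exact right_ne_zero_of_mul hβ

/-- Linearity, together with the fact that translating the data by `β` translates the `k`-th iterate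
by `2^k β`. -/
lemma iterate_subdivisionOp (c : ℤ → ℝ) (k : ℕ) (α : ℤ) :
    (subdivisionOp 2 p)^[k] c α = ∑' β : ℤ, c β * subdivDelta p k (α - 2 ^ k * β) := by
  induction k generalizing α with
  | zero =>
    rw [tsum_eq_single α]
    · simp [subdivDelta]
    · intro β hβ
      have : α - β ≠ 0 := sub_ne_zero.2 hβ.symm
      simp [subdivDelta, this]
  | succ k ih =>
    rw [Function.iterate_succ_apply', subdivisionOp_eq_sum]
    simp only [ih, ← tsum_mul_left]
    rw [← Summable.tsum_finsetSum fun γ _ => (summable_mul_subdivDelta c k γ).mul_left _]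
    refine tsum_congr fun β => ?_
    have h := subdivisionOp_eq_sum (p := p) (fun γ => subdivDelta p k (γ - 2 ^ k * β)) α
    have h2 : subdivDelta p (k + 1) (α - 2 ^ (k + 1) * β) =
        subdivisionOp 2 p (fun γ => subdivDelta p k (γ - 2 ^ k * β)) α := by
      rw [subdivDelta_succ, ← (Equiv.subRight ((2 : ℤ) ^ k * β)).tsum_eq]
      refine tsum_congr fun γ => ?_
      rw [Equiv.subRight_apply]
      congr 2
      rw [pow_succ]
      push_cast
      ring
    rw [h2, h]
    rw [Finset.mul_sum]
    exact Finset.sum_congr rfl fun γ _ => by ring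

/-- The recursion read from the other end: `S^(k+1) δ = S^k p`. It makes the new factor of the
symbol `a (2^k ω)`. -/
lemma subdivDelta_succ_eq_sum (k : ℕ) (α : ℤ) :
    subdivDelta p (k + 1) α = ∑ β ∈ p.support, p β * subdivDelta p k (α - 2 ^ k * β) := by
  have h := iterate_subdivisionOp (p := p) (subdivDelta p 1) k α
  rw [subdivDelta, ← Function.iterate_add_apply] at h
  refine h.trans ?_
  rw [← subdivDelta, subdivDelta_one]
  exact tsum_eq_sum fun β hβ => by rw [Finsupp.notMem_support_iff.1 hβ, zero_mul]

variable {a : ℝ → ℝ}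

lemma hasSum_subdivDelta_exp
    (hp : ∀ ω : ℝ, ∑ n ∈ p.support, (p n : ℂ) * Complex.exp ((n : ℝ) * ω * Complex.I) =
      ((2 * a ω : ℝ) : ℂ)) (k : ℕ) (ω : ℝ) :
    HasSum (fun α : ℤ => (subdivDelta p k α : ℂ) * Complex.exp ((α : ℝ) * ω * Complex.I))
      ((2 ^ k * ∏ j ∈ Finset.range k, a (2 ^ j * ω) : ℝ) : ℂ) := by
  induction k with
  | zero =>
    convert hasSum_single (0 : ℤ) ?_ using 1
    · simp [subdivDelta]
    · intro α hα
      simp [subdivDelta, hα]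
  | succ k ih =>
    have h : ∀ β ∈ p.support, HasSum (fun α : ℤ =>
        (p β : ℂ) * Complex.exp ((β : ℝ) * ((2 ^ k * ω : ℝ) : ℂ) * Complex.I) *
          ((subdivDelta p k (α - 2 ^ k * β) : ℂ) *
            Complex.exp (((α - 2 ^ k * β : ℤ) : ℝ) * ω * Complex.I)))
        ((p β : ℂ) * Complex.exp ((β : ℝ) * ((2 ^ k * ω : ℝ) : ℂ) * Complex.I) *
          ((2 ^ k * ∏ j ∈ Finset.range k, a (2 ^ j * ω) : ℝ) : ℂ)) := fun β _ =>
      (((Equiv.subRight ((2 : ℤ) ^ k * β)).hasSum_iff).2 ih).mul_left _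
    have hs := hasSum_sum h
    rw [← Finset.sum_mul, hp] at hs
    convert hs using 1
    · ext α
      rw [subdivDelta_succ_eq_sum]
      push_cast
      rw [Finset.sum_mul]
      refine Finset.sum_congr rfl fun β _ => ?_
      have he : Complex.exp (α * ω * Complex.I) =
          Complex.exp (β * (2 ^ k * ω) * Complex.I) *
            Complex.exp ((α - 2 ^ k * β) * ω * Complex.I) := by
        rw [← Complex.exp_add]
        congr 1
        ring
      rw [he]
      ring
    · rw [← Complex.ofReal_mul, Finset.prod_range_succ]
      congr 1
      ring

lemma integral_cos_int_mul (α : ℤ) :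
    ∫ ω in (-Real.pi)..Real.pi, Real.cos (α * ω) = if α = 0 then 2 * Real.pi else 0 := by
  split_ifs with h
  · simp [h]; ring
  · have h' : (α : ℝ) ≠ 0 := Int.cast_ne_zero.2 h
    rw [intervalIntegral.integral_comp_mul_left _ h']
    simp [Real.sin_int_mul_pi]

lemma sum_mul_cos_sub
    (hp : ∀ ω : ℝ, ∑ n ∈ p.support, (p n : ℂ) * Complex.exp ((n : ℝ) * ω * Complex.I) =
      ((2 * a ω : ℝ) : ℂ)) (s ω : ℝ) :
    ∑ n ∈ p.support, p n * Real.cos (s - n * ω) = 2 * a ω * Real.cos s := by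
  have hre : ∑ n ∈ p.support, p n * Real.cos (n * ω) = 2 * a ω := by
    have h := congrArg Complex.re (hp ω)
    rw [Complex.re_sum, Complex.ofReal_re] at h
    rw [← h]
    refine Finset.sum_congr rfl fun n _ => ?_
    rw [Complex.re_ofReal_mul, ← Complex.ofReal_mul, Complex.exp_ofReal_mul_I_re]
  have him : ∑ n ∈ p.support, p n * Real.sin (n * ω) = 0 := by
    have h := congrArg Complex.im (hp ω)
    rw [Complex.im_sum, Complex.ofReal_im] at h
    rw [← h]
    refine Finset.sum_congr rfl fun n _ => ?_
    rw [Complex.im_ofReal_mul, ← Complex.ofReal_mul, Complex.exp_ofReal_mul_I_im]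
  calc ∑ n ∈ p.support, p n * Real.cos (s - n * ω)
      = Real.cos s * ∑ n ∈ p.support, p n * Real.cos (n * ω) +
          Real.sin s * ∑ n ∈ p.support, p n * Real.sin (n * ω) := by
        rw [Finset.mul_sum, Finset.mul_sum, ← Finset.sum_add_distrib]
        refine Finset.sum_congr rfl fun n _ => ?_
        rw [Real.cos_sub]
        ring
    _ = _ := by rw [hre, him]; ring

/-- Fourier coefficients of the iterated symbol; cosines suffice because the symbol is real on the
circle. -/
lemma two_pi_mul_subdivDelta (ha : Continuous a)
    (hp : ∀ ω : ℝ, ∑ n ∈ p.support, (p n : ℂ) * Complex.exp ((n : ℝ) * ω * Complex.I) =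
      ((2 * a ω : ℝ) : ℂ)) (k : ℕ) (α : ℤ) :
    2 * Real.pi * subdivDelta p k α = 2 ^ k *
      ∫ ω in (-Real.pi)..Real.pi,
        (∏ j ∈ Finset.range k, a (2 ^ j * ω)) * Real.cos (α * ω) := by
  induction k generalizing α with
  | zero =>
    have h := integral_cos_int_mul α
    simp only [pow_zero, Finset.range_zero, Finset.prod_empty, one_mul, h]
    by_cases hα : α = 0 <;> simp [subdivDelta, hα]
  | succ k ih =>
    have h : ∀ β ∈ p.support, IntervalIntegrable (fun ω => p β *
        ((∏ j ∈ Finset.range k, a (2 ^ j * ω)) * Real.cos ((α - 2 ^ k * β : ℤ) * ω)))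
        volume (-Real.pi) Real.pi := fun β _ =>
      (by fun_prop : Continuous fun ω => p β *
        ((∏ j ∈ Finset.range k, a (2 ^ j * ω)) *
          Real.cos ((α - 2 ^ k * β : ℤ) * ω))).intervalIntegrable _ _
    calc 2 * Real.pi * subdivDelta p (k + 1) α
        = ∑ β ∈ p.support, p β * (2 * Real.pi * subdivDelta p k (α - 2 ^ k * β)) := by
          rw [subdivDelta_succ_eq_sum, Finset.mul_sum]
          exact Finset.sum_congr rfl fun β _ => by ring
      _ = 2 ^ k * ∫ ω in (-Real.pi)..Real.pi, ∑ β ∈ p.support, p β *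
            ((∏ j ∈ Finset.range k, a (2 ^ j * ω)) * Real.cos ((α - 2 ^ k * β : ℤ) * ω)) := by
          rw [intervalIntegral.integral_finsetSum h, Finset.mul_sum]
          refine Finset.sum_congr rfl fun β _ => ?_
          rw [ih, intervalIntegral.integral_const_mul]
          ring
      _ = 2 ^ k * ∫ ω in (-Real.pi)..Real.pi,
            2 * ((∏ j ∈ Finset.range (k + 1), a (2 ^ j * ω)) * Real.cos (α * ω)) := by
          congr 1
          refine intervalIntegral.integral_congr fun ω _ => ?_
          have hc := sum_mul_cos_sub hp (α * ω) (2 ^ k * ω)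
          rw [Finset.prod_range_succ]
          calc _ = (∏ j ∈ Finset.range k, a (2 ^ j * ω)) *
                ∑ β ∈ p.support, p β * Real.cos (α * ω - β * (2 ^ k * ω)) := by
                rw [Finset.mul_sum]
                refine Finset.sum_congr rfl fun β _ => ?_
                push_cast
                rw [show ((α : ℝ) - 2 ^ k * β) * ω = α * ω - β * (2 ^ k * ω) by ring]
                ring
            _ = _ := by rw [hc]; ring
      _ = _ := by
          rw [intervalIntegral.integral_const_mul]
          ring

/-- The inverse Fourier transform of an even real function. -/
noncomputable def cosTransform (f : ℝ → ℝ) (x : ℝ) : ℝ :=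
  (2 * Real.pi)⁻¹ * ∫ ω, f ω * Real.cos (ω * x)

lemma subdivDelta_eq_cosTransform (ha : Continuous a)
    (hp : ∀ ω : ℝ, ∑ n ∈ p.support, (p n : ℂ) * Complex.exp ((n : ℝ) * ω * Complex.I) =
      ((2 * a ω : ℝ) : ℂ)) (k : ℕ) (α : ℤ) :
    subdivDelta p k α = cosTransform (truncProd a k) (α / 2 ^ k) := by
  have hle : -((2 : ℝ) ^ k * Real.pi) ≤ 2 ^ k * Real.pi := by
    have : 0 ≤ (2 : ℝ) ^ k * Real.pi := by positivity
    linarith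
  have h := integral_dyadicProd (a := a) k fun ω => Real.cos (ω * (α / 2 ^ k))
  have h2 : ∀ ω : ℝ, 2 ^ k * ω * (α / 2 ^ k) = α * ω := fun ω => by field_simp
  simp only [h2] at h
  rw [← two_pi_mul_subdivDelta ha hp, intervalIntegral.integral_of_le hle,
    ← integral_indicator measurableSet_Ioc] at h
  rw [cosTransform]
  simp only [Set.indicator_mul_left] at h
  rw [eq_inv_mul_iff_mul_eq₀ (by positivity), ← h]
  rfl

lemma integrable_mul_cos {f : ℝ → ℝ} (hf : Integrable f) (x : ℝ) :
    Integrable fun ω => f ω * Real.cos (ω * x) :=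
  hf.mul_bdd (c := 1) (by fun_prop)
    (Eventually.of_forall fun ω => Real.abs_cos_le_one _)

lemma abs_cosTransform_sub_le {f g : ℝ → ℝ} (hf : Integrable f) (hg : Integrable g) (x : ℝ) :
    |cosTransform f x - cosTransform g x| ≤ (2 * Real.pi)⁻¹ * ∫ ω, |f ω - g ω| := by
  unfold cosTransform
  rw [← mul_sub, abs_mul, abs_of_nonneg (by positivity),
    ← integral_sub (integrable_mul_cos hf x) (integrable_mul_cos hg x)]
  refine mul_le_mul_of_nonneg_left ?_ (by positivity)
  refine abs_integral_le_integral_abs.trans ?_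
  refine integral_mono_of_nonneg (Eventually.of_forall fun ω => abs_nonneg _) (hf.sub hg).abs
    (Eventually.of_forall fun ω => ?_)
  simp only [← sub_mul, abs_mul]
  exact mul_le_of_le_one_right (abs_nonneg _) (Real.abs_cos_le_one _)

lemma continuous_cosTransform {f : ℝ → ℝ} (hf : Integrable f) : Continuous (cosTransform f) := by
  refine continuous_const.mul ?_
  refine continuous_of_dominated (bound := fun ω => |f ω|)
    (fun x => (integrable_mul_cos hf x).aestronglyMeasurable) (fun x => ?_) hf.abs
    (Eventually.of_forall fun ω => by fun_prop)
  refine Eventually.of_forall fun ω => ?_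
  rw [Real.norm_eq_abs, abs_mul]
  exact mul_le_of_le_one_right (abs_nonneg _) (Real.abs_cos_le_one _)

end

/-! ### Limit functions, supports and bounded data -/

lemma tendsto_iterate_floor_of_continuous {p : ℤ →₀ ℝ} {c : ℤ → ℝ} {F : ℝ → ℝ}
    (hF : Continuous F) {α : ℕ → ℤ} {x : ℝ} (hα : ∀ k, α k = ⌊(2 : ℝ) ^ k * x⌋)
    (h : Tendsto (fun k : ℕ => F (α k / 2 ^ k) - (subdivisionOp 2 p)^[k] c (α k)) atTop (𝓝 0)) :
    Tendsto (fun k : ℕ => (subdivisionOp 2 p)^[k] c (α k)) atTop (𝓝 (F x)) := by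
  have hT : Tendsto (fun k : ℕ => (2 : ℝ) ^ k) atTop atTop :=
    tendsto_pow_atTop_atTop_of_one_lt one_lt_two
  have h1 : Tendsto (fun k : ℕ => (α k : ℝ) / 2 ^ k) atTop (𝓝 x) := by
    simp only [hα]
    have h0 : Tendsto (fun k : ℕ => x - 1 / (2 : ℝ) ^ k) atTop (𝓝 x) := by
      simpa using (tendsto_inv_atTop_zero.comp hT).const_sub x
    refine tendsto_of_tendsto_of_tendsto_of_le_of_le h0 tendsto_const_nhds (fun k => ?_) fun k => ?_
    · have := (Int.sub_one_lt_floor ((2 : ℝ) ^ k * x)).le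
      change x - 1 / (2 : ℝ) ^ k ≤ _
      rw [le_div_iff₀ (by positivity), sub_mul, one_div_mul_cancel (by positivity)]
      linarith
    · change _ ≤ x
      rw [div_le_iff₀ (by positivity), mul_comm x]
      exact Int.floor_le _
  simpa using ((hF.tendsto x).comp h1).sub h

/-- Recovers a limit function at every real point from the iterates, so that support bounds and
integer values pass to the limit. -/
lemma IsLimitFunction.tendsto_iterate_floor {p : ℤ →₀ ℝ} {c : ℤ → ℝ} {F : ℝ → ℝ}
    (h : IsLimitFunction 2 p c F) (x : ℝ) :
    Tendsto (fun k : ℕ => (subdivisionOp 2 p)^[k] c ⌊(2 : ℝ) ^ k * x⌋) atTop (𝓝 (F x)) := by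
  refine tendsto_iterate_floor_of_continuous h.1.continuous (fun _ => rfl) ?_
  rw [tendsto_zero_iff_abs_tendsto_zero]
  have h4 : Tendsto (fun k : ℕ => ENNReal.ofReal |F (⌊(2 : ℝ) ^ k * x⌋ / ((2 : ℕ) : ℝ) ^ k) -
      (subdivisionOp 2 p)^[k] c ⌊(2 : ℝ) ^ k * x⌋|) atTop (𝓝 0) :=
    tendsto_of_tendsto_of_tendsto_of_le_of_le tendsto_const_nhds h.2 (fun _ => zero_le)
      fun k => le_iSup (fun α : ℤ => ENNReal.ofReal |F ((α : ℝ) / ((2 : ℕ) : ℝ) ^ k) -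
        (subdivisionOp 2 p)^[k] c α|) ⌊(2 : ℝ) ^ k * x⌋
  have h5 := (ENNReal.tendsto_toReal ENNReal.zero_ne_top).comp h4
  simpa [Function.comp_def, ENNReal.toReal_ofReal] using h5

lemma isLimitFunction_of_abs_sub_le {p : ℤ →₀ ℝ} {c : ℤ → ℝ} {F : ℝ → ℝ}
    (hF : UniformContinuous F) {e : ℕ → ℝ} (he : Tendsto e atTop (𝓝 0))
    (h : ∀ (k : ℕ) (α : ℤ), |F (α / 2 ^ k) - (subdivisionOp 2 p)^[k] c α| ≤ e k) :
    IsLimitFunction 2 p c F := by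
  refine ⟨hF, ?_⟩
  have he' : Tendsto (fun k => ENNReal.ofReal (e k)) atTop (𝓝 0) := by
    simpa using ENNReal.tendsto_ofReal he
  refine tendsto_of_tendsto_of_tendsto_of_le_of_le tendsto_const_nhds he' (fun _ => zero_le)
    fun k => iSup_le fun α => ENNReal.ofReal_le_ofReal ?_
  simpa using h k α

/-- The integers at distance at most `N` from `x`. -/
noncomputable def intsNear (N : ℕ) (x : ℝ) : Finset ℤ := Finset.Icc ⌈x - N⌉ ⌊x + N⌋

lemma mem_intsNear {N : ℕ} {x : ℝ} {β : ℤ} : β ∈ intsNear N x ↔ |x - β| ≤ N := by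
  rw [intsNear, Finset.mem_Icc, Int.ceil_le, Int.le_floor, abs_le]
  constructor <;> rintro ⟨h1, h2⟩ <;> constructor <;> linarith

lemma card_intsNear_le (N : ℕ) (x : ℝ) : (intsNear N x).card ≤ 2 * N + 1 := by
  rw [intsNear, Int.card_Icc, Int.ceil_sub_natCast, Int.floor_add_natCast]
  have := Int.floor_le_ceil x
  omega

lemma abs_tsum_mul_le {c h : ℤ → ℝ} {C ε : ℝ} (s : Finset ℤ) (hc : ∀ β, |c β| ≤ C)
    (hs : ∀ β, β ∉ s → h β = 0) (hε : ∀ β, |h β| ≤ ε) :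
    |∑' β, c β * h β| ≤ s.card * (C * ε) := by
  rw [tsum_eq_sum (s := s) fun β hβ => by rw [hs β hβ, mul_zero], ← nsmul_eq_mul]
  refine (Finset.abs_sum_le_sum_abs _ _).trans (Finset.sum_le_card_nsmul _ _ _ fun β _ => ?_)
  rw [abs_mul]
  exact mul_le_mul (hc β) (hε β) (abs_nonneg _) ((abs_nonneg _).trans (hc β))

lemma summable_mul_of_eq_zero {c h : ℤ → ℝ} (s : Finset ℤ) (hs : ∀ β, β ∉ s → h β = 0) :
    Summable fun β => c β * h β :=
  summable_of_ne_finset_zero (s := s) fun β hβ => by rw [hs β hβ, mul_zero]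

section
variable {f : ℝ → ℝ} {N : ℕ}

lemma eq_zero_of_notMem_intsNear (hf : ∀ x, (N : ℝ) < |x| → f x = 0) (x : ℝ) {β : ℤ}
    (hβ : β ∉ intsNear N x) : f (x - β) = 0 :=
  hf _ (not_le.1 (mt mem_intsNear.2 hβ))

lemma uniformContinuous_tsum_shift (hu : UniformContinuous f)
    (hf : ∀ x, (N : ℝ) < |x| → f x = 0) {c : ℤ → ℝ} {C : ℝ} (hc : ∀ β, |c β| ≤ C) :
    UniformContinuous fun x => ∑' β : ℤ, c β * f (x - β) := by
  have hC : 0 ≤ C := (abs_nonneg _).trans (hc 0)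
  rw [Metric.uniformContinuous_iff] at hu ⊢
  intro ε hε
  -- At most `2N + 1` integers are near each of `x` and `y`; `C + 1` keeps `M` positive when `C =
  -- 0`.
  set M : ℝ := (2 * (2 * N + 1) : ℝ) * (C + 1) with hM
  have hMpos : 0 < M := by positivity
  obtain ⟨δ, hδ, h⟩ := hu (ε / M / 2) (by positivity)
  refine ⟨δ, hδ, fun {x y} hxy => ?_⟩
  classical
  have hx : ∀ β, β ∉ intsNear N x ∪ intsNear N y → f (x - β) = 0 := fun β hβ =>
    eq_zero_of_notMem_intsNear hf x fun h => hβ (Finset.mem_union_left _ h)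
  have hy : ∀ β, β ∉ intsNear N x ∪ intsNear N y → f (y - β) = 0 := fun β hβ =>
    eq_zero_of_notMem_intsNear hf y fun h => hβ (Finset.mem_union_right _ h)
  rw [Real.dist_eq, ← (summable_mul_of_eq_zero _ hx).tsum_sub (summable_mul_of_eq_zero _ hy)]
  simp only [← mul_sub]
  have hcard : ((intsNear N x ∪ intsNear N y).card : ℝ) ≤ 2 * (2 * N + 1) := by
    have h1 := Finset.card_union_le (intsNear N x) (intsNear N y)
    have h2 := card_intsNear_le N x
    have h3 := card_intsNear_le N y
    exact_mod_cast h1.trans (by omega)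
  calc |∑' β : ℤ, c β * (f (x - β) - f (y - β))|
      ≤ (intsNear N x ∪ intsNear N y).card * (C * (ε / M / 2)) := by
        refine abs_tsum_mul_le _ hc (fun β hβ => by rw [hx β hβ, hy β hβ, sub_zero]) fun β => ?_
        have := h (a := x - β) (b := y - β) (by rwa [dist_sub_right])
        exact this.le
    _ ≤ (2 * (2 * N + 1)) * ((C + 1) * (ε / M / 2)) := by
        gcongr
        linarith
    _ = ε / 2 := by
        rw [← mul_assoc, ← hM]
        field_simp
    _ < ε := half_lt_self hε

end

section
variable {p : ℤ →₀ ℝ} {N : ℕ} {φ : ℝ → ℝ} {e : ℕ → ℝ}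

lemma subdivDelta_eq_zero (hN1 : 1 ≤ N) (hN : ∀ α, p α ≠ 0 → |α| ≤ N) (k : ℕ) {α : ℤ}
    (hα : (N : ℤ) * 2 ^ k ≤ |α|) : subdivDelta p k α = 0 := by
  by_contra h
  have := abs_le_of_subdivDelta_ne_zero hN k α h
  have : (1 : ℤ) ≤ N := by exact_mod_cast hN1
  linarith

lemma eq_zero_of_tendsto_subdivDelta (hN1 : 1 ≤ N) (hN : ∀ α, p α ≠ 0 → |α| ≤ N) {x y : ℝ}
    (h : Tendsto (fun k : ℕ => subdivDelta p k ⌊(2 : ℝ) ^ k * x⌋) atTop (𝓝 y))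
    (hx : (N : ℝ) < |x|) : y = 0 := by
  refine tendsto_nhds_unique h ?_
  have : ∀ k : ℕ, subdivDelta p k ⌊(2 : ℝ) ^ k * x⌋ = 0 := fun k => by
    refine subdivDelta_eq_zero hN1 hN k ?_
    have hk : (0 : ℝ) < 2 ^ k := by positivity
    rcases lt_abs.1 hx with h | h
    · refine le_trans ?_ (le_abs_self _)
      rw [Int.le_floor]
      push_cast
      nlinarith
    · refine le_trans ?_ (neg_le_abs _)
      rw [le_neg, ← @Int.cast_le ℝ]
      refine (Int.floor_le _).trans ?_
      push_cast
      nlinarith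
  simp only [this]
  exact tendsto_const_nhds

lemma tendsto_subdivDelta_two_pow_mul (h : IsBasicLimitFunction 2 p φ) (m : ℤ) :
    Tendsto (fun k : ℕ => subdivDelta p k (2 ^ k * m)) atTop (𝓝 (φ m)) := by
  refine (h.tendsto_iterate_floor m).congr fun k => ?_
  rw [show (2 : ℝ) ^ k * m = ((2 ^ k * m : ℤ) : ℝ) by push_cast; rfl, Int.floor_intCast]
  rfl

lemma isLimitFunction_tsum (hN1 : 1 ≤ N) (hN : ∀ α, p α ≠ 0 → |α| ≤ N)
    (hφ : UniformContinuous φ) (hφ0 : ∀ x, (N : ℝ) < |x| → φ x = 0)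
    (he : Tendsto e atTop (𝓝 0))
    (h : ∀ (k : ℕ) (α : ℤ), |φ (α / 2 ^ k) - subdivDelta p k α| ≤ e k)
    {c : ℤ → ℝ} {C : ℝ} (hc : ∀ β, |c β| ≤ C) :
    IsLimitFunction 2 p c fun x => ∑' β : ℤ, c β * φ (x - β) := by
  have hC : 0 ≤ C := (abs_nonneg _).trans (hc 0)
  have he0 : ∀ k, 0 ≤ e k := fun k => (abs_nonneg _).trans (h k 0)
  refine isLimitFunction_of_abs_sub_le (e := fun k => (2 * N + 1) * (C * e k))
    (uniformContinuous_tsum_shift hφ hφ0 hc) ?_ fun k α => ?_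
  · simpa using (he.const_mul C).const_mul (2 * (N : ℝ) + 1)
  have h2 : (0 : ℝ) < 2 ^ k := by positivity
  have hx : ∀ β : ℤ, (α : ℝ) / 2 ^ k - β = ((α - 2 ^ k * β : ℤ) : ℝ) / 2 ^ k := fun β => by
    push_cast
    field_simp
  have h0 : ∀ β, β ∉ intsNear N ((α : ℝ) / 2 ^ k) → φ ((α : ℝ) / 2 ^ k - β) = 0 := fun β hβ =>
    eq_zero_of_notMem_intsNear hφ0 _ hβ
  have h1 : ∀ β, β ∉ intsNear N ((α : ℝ) / 2 ^ k) → subdivDelta p k (α - 2 ^ k * β) = 0 :=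
    fun β hβ => by
      refine subdivDelta_eq_zero hN1 hN k ?_
      rw [mem_intsNear, not_le, hx, abs_div, abs_of_pos h2, lt_div_iff₀ h2] at hβ
      exact_mod_cast hβ.le
  rw [iterate_subdivisionOp, ← (summable_mul_of_eq_zero _ h0).tsum_sub
    (summable_mul_subdivDelta c k α)]
  simp only [← mul_sub]
  refine (abs_tsum_mul_le (intsNear N ((α : ℝ) / 2 ^ k)) hc (fun β hβ => ?_) fun β => ?_).trans
    (mul_le_mul_of_nonneg_right (b := ((intsNear N ((α : ℝ) / 2 ^ k)).card : ℝ)) ?_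
      (mul_nonneg hC (he0 k)))
  · rw [h0 β hβ, h1 β hβ, sub_zero]
  · rw [hx]
    exact h k _
  · exact_mod_cast card_intsNear_le N _

lemma eq_zero_of_abs_sub_subdivDelta_le (hN1 : 1 ≤ N) (hN : ∀ α, p α ≠ 0 → |α| ≤ N)
    (hφ : Continuous φ) (he : Tendsto e atTop (𝓝 0))
    (h : ∀ (k : ℕ) (α : ℤ), |φ (α / 2 ^ k) - subdivDelta p k α| ≤ e k) (x : ℝ)
    (hx : (N : ℝ) < |x|) : φ x = 0 :=
  eq_zero_of_tendsto_subdivDelta hN1 hN (tendsto_iterate_floor_of_continuous hφ (fun _ => rfl)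
    (squeeze_zero_norm (fun k => h k _) he)) hx

lemma hasCompactSupport_of_eq_zero (h : ∀ x, (N : ℝ) < |x| → φ x = 0) : HasCompactSupport φ :=
  HasCompactSupport.intro (isCompact_Icc (a := -(N : ℝ)) (b := N)) fun x hx => h x <| by
    contrapose! hx
    exact abs_le.1 hx

end

/-! ### Positivity of the Fourier series of the integer samples -/

lemma sum_exp_two_pi_mul_div (α : ℤ) {M : ℕ} (hM : M ≠ 0) :
    ∑ l ∈ Finset.range M, Complex.exp (2 * Real.pi * Complex.I * (α / M)) ^ l =
      if (M : ℤ) ∣ α then (M : ℂ) else 0 := by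
  have hM' : (M : ℂ) ≠ 0 := Nat.cast_ne_zero.2 hM
  set ζ := Complex.exp (2 * Real.pi * Complex.I * (α / M)) with hζ
  split_ifs with h
  · obtain ⟨m, rfl⟩ := h
    have : ζ = 1 := by
      rw [hζ, Complex.exp_eq_one_iff]
      refine ⟨m, ?_⟩
      push_cast
      field_simp
    simp [this]
  · have h1 : ζ - 1 ≠ 0 := by
      rw [sub_ne_zero, hζ, Ne, Complex.exp_eq_one_iff]
      rintro ⟨n, hn⟩
      apply h
      refine ⟨n, ?_⟩
      have h2 : (α : ℂ) / M = n := by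
        have hne : (2 * Real.pi * Complex.I : ℂ) ≠ 0 := Complex.two_pi_I_ne_zero
        rw [mul_comm (n : ℂ)] at hn
        exact mul_left_cancel₀ hne hn
      rw [div_eq_iff hM'] at h2
      rw [mul_comm]
      exact_mod_cast h2
    have h3 : ζ ^ M = 1 := by
      rw [hζ, ← Complex.exp_nat_mul, Complex.exp_eq_one_iff]
      refine ⟨α, ?_⟩
      field_simp
    have h4 := mul_geom_sum ζ M
    rw [h3, sub_self] at h4
    exact (mul_eq_zero.1 h4).resolve_left h1

section
variable {p : ℤ →₀ ℝ} {a φ : ℝ → ℝ} {N : ℕ}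

/-- Discrete Poisson summation: summing the iterated symbol over the points `(ω + 2πl) / 2^k` keeps
only the coefficients at multiples of `2^k`. -/
lemma dyadicProd_le_sum_subdivDelta_mul_cos
    (hp : ∀ ω : ℝ, ∑ n ∈ p.support, (p n : ℂ) * Complex.exp ((n : ℝ) * ω * Complex.I) =
      ((2 * a ω : ℝ) : ℂ)) (h0 : ∀ ω, 0 ≤ a ω) (hN1 : 1 ≤ N)
    (hN : ∀ α, p α ≠ 0 → |α| ≤ N) (k : ℕ) (ω : ℝ) :
    dyadicProd a k ω ≤
      ∑ m ∈ Finset.Icc (-(N : ℤ)) N, subdivDelta p k (2 ^ k * m) * Real.cos (m * ω) := by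
  set θ : ℕ → ℝ := fun l => (ω + 2 * Real.pi * l) / 2 ^ k with hθ
  set Q : ℝ → ℝ := fun t => ∏ j ∈ Finset.range k, a (2 ^ j * t) with hQ
  have hQ0 : ∀ t, 0 ≤ Q t := fun t => Finset.prod_nonneg fun _ _ => h0 _
  have hsum := hasSum_sum fun l (_ : l ∈ Finset.range (2 ^ k)) =>
    hasSum_subdivDelta_exp hp k (θ l)
  have hexp : ∀ α : ℤ, ∑ l ∈ Finset.range (2 ^ k),
      (subdivDelta p k α : ℂ) * Complex.exp ((α : ℝ) * θ l * Complex.I) =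
        (subdivDelta p k α : ℂ) * Complex.exp (α * (ω / 2 ^ k) * Complex.I) *
          if ((2 ^ k : ℕ) : ℤ) ∣ α then ((2 ^ k : ℕ) : ℂ) else 0 := fun α => by
    rw [← sum_exp_two_pi_mul_div α (by positivity : 2 ^ k ≠ 0), Finset.mul_sum]
    refine Finset.sum_congr rfl fun l _ => ?_
    rw [← Complex.exp_nat_mul, mul_assoc (subdivDelta p k α : ℂ), ← Complex.exp_add]
    congr 2
    simp only [hθ]
    push_cast
    field_simp
  simp only [hexp] at hsum
  have hinj : Function.Injective fun m : ℤ => (2 : ℤ) ^ k * m := fun m n h =>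
    mul_left_cancel₀ (by positivity : (2 : ℤ) ^ k ≠ 0) h
  replace hsum := (hinj.hasSum_iff fun α hα => by
    rw [if_neg, mul_zero]
    rintro ⟨m, rfl⟩
    exact hα ⟨m, by push_cast; rfl⟩).2 hsum
  have hfin := hasSum_sum_of_ne_finset_zero (L := .unconditional ℤ) (s := Finset.Icc (-(N : ℤ)) N)
    (f := (fun α : ℤ => (subdivDelta p k α : ℂ) * Complex.exp (α * (ω / 2 ^ k) * Complex.I) *
          if ((2 ^ k : ℕ) : ℤ) ∣ α then ((2 ^ k : ℕ) : ℂ) else 0) ∘ fun m : ℤ => (2 : ℤ) ^ k * m)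
    fun m hm => by
      have hm' : (N : ℤ) < |m| := by
        by_contra! h
        exact hm (Finset.mem_Icc.2 (abs_le.1 h))
      have : subdivDelta p k (2 ^ k * m) = 0 := by
        refine subdivDelta_eq_zero hN1 hN k ?_
        rw [abs_mul, abs_of_pos (by positivity : (0 : ℤ) < 2 ^ k), mul_comm]
        gcongr
      simp [this]
  have heq := congrArg Complex.re (hfin.unique hsum)
  rw [← Complex.ofReal_sum, Complex.ofReal_re, Complex.re_sum] at heq
  have hterm : ∀ m : ℤ, (((fun α : ℤ => (subdivDelta p k α : ℂ) *
      Complex.exp (α * (ω / 2 ^ k) * Complex.I) *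
          if ((2 ^ k : ℕ) : ℤ) ∣ α then ((2 ^ k : ℕ) : ℂ) else 0) ∘
            fun m : ℤ => (2 : ℤ) ^ k * m) m).re =
      2 ^ k * (subdivDelta p k (2 ^ k * m) * Real.cos (m * ω)) := fun m => by
    have hdvd : ((2 ^ k : ℕ) : ℤ) ∣ 2 ^ k * m := ⟨m, by push_cast; rfl⟩
    have harg : (((2 ^ k * m : ℤ) : ℂ) * (ω / 2 ^ k) * Complex.I) =
        ((m * ω : ℝ) : ℂ) * Complex.I := by
      push_cast
      field_simp
    simp only [Function.comp_apply, if_pos hdvd]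
    rw [harg, mul_comm, show ((2 ^ k : ℕ) : ℂ) = ((2 ^ k : ℝ) : ℂ) by push_cast; rfl,
      Complex.re_ofReal_mul, Complex.re_ofReal_mul, Complex.exp_ofReal_mul_I_re]
  simp only [hterm, ← Finset.mul_sum] at heq
  have hcancel := mul_left_cancel₀ (by positivity : (2 : ℝ) ^ k ≠ 0) heq
  rw [hcancel]
  -- All summands are nonnegative, so the one at `l = 0`, which is the dyadic product at `ω`, bounds
  -- the sum from below.
  have hle := Finset.single_le_sum (f := fun l => Q (θ l)) (fun l _ => hQ0 (θ l))
    (Finset.mem_range.2 (by positivity : 0 < 2 ^ k))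
  refine le_trans (le_of_eq ?_) hle
  simp only [hQ, hθ]
  rw [← dyadicProd_eq_prod_mul]
  congr 1
  simp only [Nat.cast_zero, mul_zero, add_zero]
  field_simp

lemma le_sum_basicLimitFunction_mul_cos
    (hp : ∀ ω : ℝ, ∑ n ∈ p.support, (p n : ℂ) * Complex.exp ((n : ℝ) * ω * Complex.I) =
      ((2 * a ω : ℝ) : ℂ)) (h0 : ∀ ω, 0 ≤ a ω) {J : ℕ}
    (hc : ∀ ω, Real.cos (ω / 2) ^ (2 * J) ≤ a ω) (hN1 : 1 ≤ N)
    (hN : ∀ α, p α ≠ 0 → |α| ≤ N) (hφ : IsBasicLimitFunction 2 p φ) {ω : ℝ}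
    (hω : |ω| ≤ Real.pi) :
    (2 / Real.pi) ^ (2 * J) ≤
      ∑ m ∈ Finset.Icc (-(N : ℤ)) N, φ m * Real.cos (m * ω) :=
  ge_of_tendsto' (tendsto_finsetSum _ fun m _ =>
    (tendsto_subdivDelta_two_pow_mul hφ m).mul_const _) fun k =>
      (le_dyadicProd hc hω k).trans (dyadicProd_le_sum_subdivDelta_mul_cos hp h0 hN1 hN k ω)

end

/-! ### Convolution operators bounded below on `ℓ^∞` -/

section
variable {E : Type*} [NormedAddCommGroup E] [NormedSpace ℂ E]

/-- For an isometry each factor satisfies `‖S y - r y‖ ≥ |1 - ‖r‖| ‖y‖`; the constants multiply. -/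
lemma exists_le_norm_aeval_prod_X_sub_C (S : Module.End ℂ E) (hS : ∀ x, ‖S x‖ = ‖x‖)
    (s : Multiset ℂ) (hs : ∀ r ∈ s, ‖r‖ ≠ 1) :
    ∃ A : ℝ, 0 < A ∧ ∀ x, A * ‖x‖ ≤
      ‖Polynomial.aeval S (s.map fun r => Polynomial.X - Polynomial.C r).prod x‖ := by
  induction s using Multiset.induction_on with
  | empty => exact ⟨1, one_pos, fun x => by simp⟩
  | cons r s ih =>
    obtain ⟨A, hA, h⟩ := ih fun q hq => hs q (Multiset.mem_cons_of_mem hq)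
    have hr : 0 < |1 - ‖r‖| :=
      abs_pos.2 (sub_ne_zero.2 (hs r (Multiset.mem_cons_self r s)).symm)
    refine ⟨|1 - ‖r‖| * A, mul_pos hr hA, fun x => ?_⟩
    rw [Multiset.map_cons, Multiset.prod_cons, map_mul, Module.End.mul_apply]
    set y := Polynomial.aeval S (s.map fun r => Polynomial.X - Polynomial.C r).prod x with hy
    have h1 : Polynomial.aeval S (Polynomial.X - Polynomial.C r) y = S y - r • y := by
      simp
    rw [h1, mul_assoc]
    calc |1 - ‖r‖| * (A * ‖x‖) ≤ |1 - ‖r‖| * ‖y‖ := by gcongr; exact h x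
      _ = |‖S y‖ - ‖r • y‖| := by
        rw [hS, norm_smul, ← abs_of_nonneg (norm_nonneg y), ← abs_mul,
          abs_of_nonneg (norm_nonneg y)]
        congr 1
        ring
      _ ≤ ‖S y - r • y‖ := abs_norm_sub_norm_le _ _

/-- A polynomial without zeros on the unit circle is bounded below on a linear isometry. -/
lemma exists_le_norm_aeval (S : Module.End ℂ E) (hS : ∀ x, ‖S x‖ = ‖x‖) (P : Polynomial ℂ)
    (hP : ∀ z : ℂ, ‖z‖ = 1 → P.eval z ≠ 0) :
    ∃ A : ℝ, 0 < A ∧ ∀ x, A * ‖x‖ ≤ ‖Polynomial.aeval S P x‖ := by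
  have hP0 : P ≠ 0 := by
    rintro rfl
    exact hP 1 norm_one Polynomial.eval_zero
  obtain ⟨A, hA, h⟩ := exists_le_norm_aeval_prod_X_sub_C S hS P.roots fun r hr hr1 =>
    hP r hr1 (Polynomial.isRoot_of_mem_roots hr)
  have hl : 0 < ‖P.leadingCoeff‖ := norm_pos_iff.2 (Polynomial.leadingCoeff_ne_zero.2 hP0)
  refine ⟨‖P.leadingCoeff‖ * A, mul_pos hl hA, fun x => ?_⟩
  have heq : Polynomial.aeval S P x = P.leadingCoeff •
      Polynomial.aeval S (P.roots.map fun r => Polynomial.X - Polynomial.C r).prod x := by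
    conv_lhs => rw [(IsAlgClosed.splits P).eq_prod_roots]
    rw [map_mul, Polynomial.aeval_C, Module.End.mul_apply, Module.algebraMap_end_apply]
  rw [heq, norm_smul, mul_assoc]
  exact mul_le_mul_of_nonneg_left (h x) hl.le

end

open scoped BoundedContinuousFunction in
/-- The shift `(S x) n = x (n - 1)` on bounded sequences. -/
noncomputable def boundedShift : Module.End ℂ (ℤ →ᵇ ℂ) where
  toFun x := x.compContinuous ⟨fun n => n - 1, continuous_of_discreteTopology⟩
  map_add' _ _ := rfl
  map_smul' _ _ := rfl

open scoped BoundedContinuousFunction in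
lemma boundedShift_apply (x : ℤ →ᵇ ℂ) (n : ℤ) : boundedShift x n = x (n - 1) := rfl

open scoped BoundedContinuousFunction in
lemma boundedShift_pow_apply (x : ℤ →ᵇ ℂ) (i : ℕ) (n : ℤ) :
    (boundedShift ^ i) x n = x (n - i) := by
  induction i generalizing n with
  | zero => simp
  | succ i ih =>
    rw [pow_succ', Module.End.mul_apply, boundedShift_apply, ih]
    congr 1
    push_cast
    ring

open scoped BoundedContinuousFunction in
lemma norm_boundedShift (x : ℤ →ᵇ ℂ) : ‖boundedShift x‖ = ‖x‖ := by
  refine le_antisymm ?_ ?_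
  · exact (BoundedContinuousFunction.norm_le (norm_nonneg _)).2 fun n => x.norm_coe_le_norm _
  · refine (BoundedContinuousFunction.norm_le (norm_nonneg _)).2 fun n => ?_
    have h := (boundedShift x).norm_coe_le_norm (n + 1)
    rwa [boundedShift_apply, add_sub_cancel_right] at h

/-- A finitely supported real sequence whose Fourier series has positive real part acts by
convolution as an operator bounded below on `ℓ^∞`. -/
lemma exists_norm_le_of_convolution_le {b : ℤ → ℝ} {N : ℕ}
    (hb : ∀ ω : ℝ, |ω| ≤ Real.pi →
      0 < ∑ m ∈ Finset.Icc (-(N : ℤ)) N, b m * Real.cos (m * ω)) :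
    ∃ A : ℝ, 0 < A ∧ ∀ (c : lp (fun _ : ℤ => ℝ) ∞) (K : ℝ),
      (∀ n : ℤ, |∑ m ∈ Finset.Icc (-(N : ℤ)) N, b m * c (n - m)| ≤ K) → A * ‖c‖ ≤ K := by
  have hreindex : ∀ {M : Type} [AddCommMonoid M] (f : ℤ → M),
      ∑ i ∈ Finset.range (2 * N + 1), f ((i : ℤ) - N) = ∑ m ∈ Finset.Icc (-(N : ℤ)) N, f m := by
    intro M _ f
    refine Finset.sum_bij (fun i _ => (i : ℤ) - N) (fun i hi => ?_) (fun i _ j _ h => ?_)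
      (fun m hm => ?_) fun _ _ => rfl
    · rw [Finset.mem_range] at hi
      rw [Finset.mem_Icc]
      omega
    · omega
    · rw [Finset.mem_Icc] at hm
      exact ⟨(m + N).toNat, Finset.mem_range.2 (by omega), by omega⟩
  -- `z^N` times the Laurent polynomial of `b`; the extra factor only shifts the output by `N`,
  -- which leaves the supremum unchanged.
  set P : Polynomial ℂ := ∑ i ∈ Finset.range (2 * N + 1),
    Polynomial.C (b ((i : ℤ) - N) : ℂ) * Polynomial.X ^ i with hPdef
  have hP : ∀ z : ℂ, ‖z‖ = 1 → P.eval z ≠ 0 := by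
    intro z hz h
    have hz0 : z ≠ 0 := by
      rintro rfl
      simp at hz
    have hzexp : z = Complex.exp (z.arg * Complex.I) := by
      have := Complex.norm_mul_exp_arg_mul_I z
      rwa [hz, Complex.ofReal_one, one_mul, eq_comm] at this
    have h1 : P.eval z = z ^ N * ∑ m ∈ Finset.Icc (-(N : ℤ)) N, (b m : ℂ) * z ^ m := by
      rw [← hreindex, Finset.mul_sum, hPdef, Polynomial.eval_finsetSum]
      refine Finset.sum_congr rfl fun i _ => ?_
      rw [zpow_sub₀ hz0, zpow_natCast, zpow_natCast]
      simp only [Polynomial.eval_mul, Polynomial.eval_C, Polynomial.eval_pow, Polynomial.eval_X]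
      field_simp
    rw [h1] at h
    have h2 := congrArg Complex.re ((mul_eq_zero.1 h).resolve_left (pow_ne_zero _ hz0))
    rw [Complex.re_sum, Complex.zero_re] at h2
    refine (hb z.arg (Complex.abs_arg_le_pi z)).ne' (h2 ▸ Finset.sum_congr rfl fun m _ => ?_)
    rw [Complex.re_ofReal_mul]
    conv_rhs => rw [hzexp]
    rw [← Complex.exp_int_mul, ← mul_assoc, ← Complex.ofReal_intCast, ← Complex.ofReal_mul,
      Complex.exp_ofReal_mul_I_re]
  obtain ⟨A, hA, h⟩ := exists_le_norm_aeval boundedShift norm_boundedShift P hP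
  refine ⟨A, hA, fun c K hK => ?_⟩
  have hcn : ∀ n, ‖(c n : ℂ)‖ ≤ ‖c‖ := fun n => by
    rw [Complex.norm_real]
    exact lp.norm_apply_le_norm ENNReal.top_ne_zero c n
  set x := BoundedContinuousFunction.ofNormedAddCommGroupDiscrete (fun n => (c n : ℂ)) ‖c‖ hcn
    with hx
  have hxc : ‖c‖ ≤ ‖x‖ := lp.norm_le_of_forall_le (norm_nonneg _) fun n => by
    have := x.norm_coe_le_norm n
    rwa [hx, BoundedContinuousFunction.coe_ofNormedAddCommGroupDiscrete, Complex.norm_real] at this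
  have hconv : ∀ n : ℤ, Polynomial.aeval boundedShift P x n =
      ((∑ m ∈ Finset.Icc (-(N : ℤ)) N, b m * c (n - N - m) : ℝ) : ℂ) := fun n => by
    rw [← hreindex, hPdef, map_sum, LinearMap.sum_apply, BoundedContinuousFunction.coe_sum,
      Finset.sum_apply, Complex.ofReal_sum]
    refine Finset.sum_congr rfl fun i _ => ?_
    rw [map_mul, Polynomial.aeval_C, map_pow, Polynomial.aeval_X, Module.End.mul_apply,
      Module.algebraMap_end_apply, BoundedContinuousFunction.smul_apply, boundedShift_pow_apply,
      Complex.ofReal_mul, smul_eq_mul, show n - (N : ℤ) - ((i : ℤ) - N) = n - i by ring]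
    rfl
  have hK0 : 0 ≤ K := (abs_nonneg _).trans (hK 0)
  refine (mul_le_mul_of_nonneg_left hxc hA.le).trans ((h x).trans ?_)
  refine (BoundedContinuousFunction.norm_le hK0).2 fun n => ?_
  rw [hconv, Complex.norm_real]
  exact hK (n - N)

/-! ### Pointwise bounds, convergence and stability -/

/-- The bound holds almost everywhere, hence on a dense set, which is closed by continuity. -/
lemma ofReal_abs_le_eLpNorm_top {f : ℝ → ℝ} (hf : Continuous f) (x : ℝ) :
    ENNReal.ofReal |f x| ≤ eLpNorm f ∞ volume := by
  rw [← Real.norm_eq_abs, ofReal_norm, eLpNorm_exponent_top]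
  have hd := Measure.dense_of_ae (ae_le_eLpNormEssSup (f := f) (μ := volume))
  have hc : IsClosed {y | ‖f y‖ₑ ≤ eLpNormEssSup f volume} :=
    isClosed_le hf.enorm continuous_const
  have := hc.closure_eq ▸ hd.closure_eq
  exact (this ▸ Set.mem_univ x : x ∈ {y | ‖f y‖ₑ ≤ eLpNormEssSup f volume})

section
variable {p : ℤ →₀ ℝ} {a b : ℝ → ℝ}

/-- Convergence for a nonnegative symbol dominated by an interpolatory one. -/
lemma isConvergent_of_le_interpolatory (ha : Continuous a) (h0 : ∀ ω, 0 ≤ a ω)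
    (hab : ∀ ω, a ω ≤ b ω) (hb : Continuous b) (hb1 : ∀ ω, b ω ≤ 1)
    (hper : ∀ ω, b (ω + 2 * Real.pi) = b ω) (hadd : ∀ ω, b ω + b (ω + Real.pi) = 1)
    {J : ℕ} (hc : ∀ ω, Real.cos (ω / 2) ^ (2 * J) ≤ b ω)
    (hp : ∀ ω : ℝ, ∑ n ∈ p.support, (p n : ℂ) * Complex.exp ((n : ℝ) * ω * Complex.I) =
      ((2 * a ω : ℝ) : ℂ)) :
    IsConvergent 2 p := by
  obtain ⟨hint, hinf, hlim⟩ := tendsto_integral_truncProd_sub ha h0 hab hb hb1 hper hadd hc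
  obtain ⟨N, hN1, hN⟩ := exists_support_bound p
  set φ := cosTransform (dyadicInfProd a) with hφdef
  set e : ℕ → ℝ := fun k => (2 * Real.pi)⁻¹ * ∫ ω, |truncProd a k ω - dyadicInfProd a ω|
  have he : Tendsto e atTop (𝓝 0) := mul_zero (2 * Real.pi)⁻¹ ▸ hlim.const_mul (2 * Real.pi)⁻¹
  have h : ∀ (k : ℕ) (α : ℤ), |φ (α / 2 ^ k) - subdivDelta p k α| ≤ e k := fun k α => by
    rw [subdivDelta_eq_cosTransform ha hp, abs_sub_comm]
    exact abs_cosTransform_sub_le (hint k) hinf _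
  have hφ : Continuous φ := continuous_cosTransform hinf
  have hφ0 := eq_zero_of_abs_sub_subdivDelta_le hN1 hN hφ he h
  have hφu := (hasCompactSupport_of_eq_zero hφ0).uniformContinuous_of_continuous hφ
  exact fun c => ⟨_, isLimitFunction_tsum hN1 hN hφu hφ0 he h (C := ‖c‖) fun β =>
    lp.norm_apply_le_norm ENNReal.top_ne_zero c β⟩

/-- Stability of the basic limit function of a scheme with nonnegative symbol. -/
lemma isLInftyStable_of_isBasicLimitFunction (h0 : ∀ ω, 0 ≤ a ω) {J : ℕ}
    (hc : ∀ ω, Real.cos (ω / 2) ^ (2 * J) ≤ a ω)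
    (hp : ∀ ω : ℝ, ∑ n ∈ p.support, (p n : ℂ) * Complex.exp ((n : ℝ) * ω * Complex.I) =
      ((2 * a ω : ℝ) : ℂ)) {φ : ℝ → ℝ} (hφ : IsBasicLimitFunction 2 p φ) :
    IsLInftyStable φ := by
  obtain ⟨N, hN1, hN⟩ := exists_support_bound p
  have hφ0 : ∀ x, (N : ℝ) < |x| → φ x = 0 := fun x hx =>
    eq_zero_of_tendsto_subdivDelta hN1 hN (hφ.tendsto_iterate_floor x) hx
  have hcs := hasCompactSupport_of_eq_zero hφ0
  have hcont : Continuous φ := hφ.1.continuous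
  refine ⟨hcont.memLp_top_of_hasCompactSupport hcs volume, hcs, ?_⟩
  obtain ⟨A, hA, hlow⟩ := exists_norm_le_of_convolution_le (b := fun m => φ m) (N := N)
    fun ω hω => lt_of_lt_of_le (by have := Real.pi_pos; positivity)
      (le_sum_basicLimitFunction_mul_cos hp h0 hc hN1 hN hφ hω)
  obtain ⟨M, hM⟩ := hcs.exists_bound_of_continuous hcont
  -- The maximum enforces `A ≤ B`; at most `2N + 1` translates meet a point, each bounded by `M`.
  refine ⟨A, max A ((2 * N + 1) * M), hA, le_max_left _ _, fun c => ?_⟩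
  have hcn : ∀ β, |c β| ≤ ‖c‖ := fun β => lp.norm_apply_le_norm ENNReal.top_ne_zero c β
  constructor
  · have hF := (uniformContinuous_tsum_shift hφ.1 hφ0 hcn).continuous
    -- An infinite norm is set aside because `toReal` would send it to `0`.
    by_cases htop : eLpNorm (fun t : ℝ => ∑' α : ℤ, c α * φ (t - α)) ∞ volume = ⊤
    · rw [htop]
      exact le_top
    refine ENNReal.ofReal_le_of_le_toReal (hlow c _ fun n => ?_)
    have h1 := ofReal_abs_le_eLpNorm_top hF n
    rw [ENNReal.ofReal_le_iff_le_toReal htop] at h1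
    refine le_trans (le_of_eq ?_) h1
    congr 1
    have h2 : ∀ m, m ∉ Finset.Icc (-(N : ℤ)) N → φ m * c (n - m) = 0 := fun m hm => by
      rw [hφ0 m, zero_mul]
      by_contra! h
      exact hm (Finset.mem_Icc.2 (abs_le.1 (by exact_mod_cast h)))
    rw [← tsum_eq_sum (L := .unconditional ℤ) h2, ← (Equiv.subLeft n).tsum_eq]
    refine tsum_congr fun m => ?_
    rw [Equiv.subLeft_apply, sub_sub_cancel, mul_comm]
    push_cast
    rfl
  · have hM0 : 0 ≤ M := (norm_nonneg _).trans (hM 0)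
    rw [eLpNorm_exponent_top]
    refine eLpNormEssSup_le_of_ae_bound (Eventually.of_forall fun x => ?_)
    refine (abs_tsum_mul_le (intsNear N x) hcn
      (fun β hβ => eq_zero_of_notMem_intsNear hφ0 x hβ) fun β => hM _).trans ?_
    have h1 : ((intsNear N x).card : ℝ) ≤ 2 * N + 1 := by exact_mod_cast card_intsNear_le N x
    calc ((intsNear N x).card : ℝ) * (‖c‖ * M) ≤ (2 * N + 1) * (‖c‖ * M) := by gcongr
      _ = (2 * N + 1) * M * ‖c‖ := by ring
      _ ≤ _ := by gcongr; exact le_max_right _ _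

end

end Subdivision

theorem proposition4p2 (J L : ℕ) (hJ : 1 ≤ J) (hL : L ≤ J - 1) :
    Subdivision.IsConvergent 2 (Subdivision.pseudoSplineMask J L) ∧
      ∀ φ : ℝ → ℝ,
        Subdivision.IsBasicLimitFunction 2 (Subdivision.pseudoSplineMask J L) φ →
          Subdivision.IsLInftyStable φ := by
  obtain ⟨n, rfl⟩ : ∃ n, J = n + 1 := ⟨J - 1, by omega⟩
  have hLn : L ≤ n := by omega
  -- The dominating interpolatory symbol has the same `J = n + 1` and `L = n`.
  exact ⟨Subdivision.isConvergent_of_le_interpolatory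
      (Subdivision.continuous_halfSymbol _ _) (Subdivision.halfSymbol_nonneg _ _)
      (Subdivision.halfSymbol_mono _ hLn) (Subdivision.continuous_halfSymbol _ _)
      (Subdivision.halfSymbol_le_one hJ le_rfl) (Subdivision.halfSymbol_add_two_pi _ _)
      (Subdivision.halfSymbol_interp_add_pi n) (Subdivision.cos_pow_le_halfSymbol _ _)
      (Subdivision.sum_pseudoSplineMask_exp _ _),
    fun _ hφ => Subdivision.isLInftyStable_of_isBasicLimitFunction
      (Subdivision.halfSymbol_nonneg _ _) (Subdivision.cos_pow_le_halfSymbol _ _)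
      (Subdivision.sum_pseudoSplineMask_exp _ _) hφ⟩
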